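/- **Setting.** Let $(\mathsf X,\mathcal X)$ be a measurable space, $M_0$ a probability measure on it, $(M_t)_{t\ge1}$ Markov kernels on $\mathsf X\times\mathcal X$ and $(g_t)_{t\ge0}$ non-negative measurable functions on $\mathsf X$. Assume: * (A1) $M_0(dx)=m_0(x)\,\nu(dx)$ and $M_t(x',dx)=m_t(x',x)\,\nu(dx)$ for all $t\ge1$, $x'\in\mathsf X$, for a measure $\nu$ and (jointly) measurable densities; * (A2) there is $G_\infty>0$ with $0<g_t(x)\le G_\infty$ for all $t\ge0$, $x\in\mathsf X$; * (A3) $m_t(x',x)>0$ for all $t\ge1$, $x,x'\in\mathsf X$; * (A4) there is $\sigma_+>0$ with $m_t(x',x)\le\sigma_+$ for all $t\ge1$, $x,x'\in\mathsf X$. Put $Q_{t+1}(x,dy)=g_t(x)M_{t+1}(x,dy)$, let $Q_{s+1:t}$ be the composition of $Q_{s+1},\dots,Q_t$ (the identity if $s=t$), $\gamma_0=M_0$, $\gamma_{t+1}=\gamma_tQ_{t+1}$, and $$\sigma^2_{\gamma,t}(h)=\sum_{s=0}^t\big\{\gamma_s(\mathbf 1)\,\gamma_s\big(Q_{s+1:t}[h]^2\big)-\gamma_t(h)^2\big\}.$$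 **Algorithm.** Given $N,M\ge1$, draw $\xi_0^1,\dots,\xi_0^N$ i.i.d. from $M_0$. At step $t\to t+1$ let $\omega_t^i=g_t(\xi_t^i)$, $\Omega_t=\sum_i\omega_t^i$, $W_t^i=\omega_t^i/\Omega_t$. Conditionally on the past, draw ancestor indices $A_t^1,\dots,A_t^N$ i.i.d. with law $W_t^{1:N}$; then independently $\xi_{t+1}^i\sim M_{t+1}(\xi_t^{A_t^i},\cdot)$; then, independently over $k\in[N]$ and $i\in[M]$, backward indices $J^i_{k,t}$ equal to $\ell$ with probability $\omega_t^\ell m_{t+1}(\xi_t^\ell,\xi_{t+1}^k)\big/\sum_j\omega_t^jm_{t+1}(\xi_t^j,\xi_{t+1}^k)$. Set $\gamma_t^N(h)=\big\{\prod_{s<t}N^{-1}\Omega_s\big\}N^{-1}\sum_ih(\xi_t^i)$. For $b\in\{0,1\}^{t+1}$ define the coalescence statistics by $\widetilde{\mathcal T}^b_0(k,\ell)=\mathbb 1_{k\ne\ell,\,b_0=0}+\mathbb 1_{k=\ell,\,b_0=1}$ and, for $t\ge1$, $$\widetilde{\mathcal T}^b_t(k,\ell)=\begin{cases}\dfrac{\mathbb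 1_{k\neq\ell}}{M}\displaystyle\sum_{i=1}^M\widetilde{\mathcal T}^b_{t-1}(J^i_{k,t-1},J^i_{\ell,t-1})&\text{if }b_t=0,\\[2mm]\dfrac{\mathbb 1_{k=\ell}}{M}\displaystyle\sum_{i=1}^M\sum_{j=1}^NW_{t-1}^j\,\widetilde{\mathcal T}^b_{t-1}(J^i_{k,t-1},j)&\text{if }b_t=1,\end{cases}$$ where $\widetilde{\mathcal T}^b_{t-1}$ uses only $b_0,\dots,b_{t-1}$. Put $$\tilde\gamma^{N,M}_{b,t}(f)=\Big\{\prod_{s=0}^tN^{b_s}\Big(\tfrac N{N-1}\Big)^{1-b_s}\Big\}\frac{\gamma_t^N(\mathbf 1)^2}{N^2}\sum_{i,j=1}^N\widetilde{\mathcal T}^b_t(i,j)f(\xi_t^i,\xi_t^j).$$ **Theorem.** Assume (A1)–(A4). Let $t\ge0$, let $M>1$ be a fixed integer and let $h:\mathsf X\to\mathbb R$ be bounded and measurable. Then, whatever probability spaces carry the runs of the algorithm for the different values of $N$, $$N\big(\gamma_t^N(h)^2-\tilde\gamma^{N,M}_{\mathbf 0,t}(h\otimes h)\big)\longrightarrow\sigma^2_{\gamma,t}(h)\quad\text{in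 probability as }N\to\infty.$$ Moreover, for every $N\ge1$, every realisation of the algorithm and all $k,\ell\in[N]$, $\sum_{b\in\{0,1\}^{t+1}}\widetilde{\mathcal T}^b_t(k,\ell)=1$. -/

import Mathlib

open MeasureTheory ProbabilityTheory Filter Topology

noncomputable section

namespace Paris

/-! ### Product kernels and categorical kernels -/

/-- A finite product of measurable families of finite measures is a measurable family. -/
theorem measurable_pi_measure {α E ι : Type*} [MeasurableSpace α] [MeasurableSpace E] [Fintype ι]
    (μ : ι → α → Measure E) [∀ i a, IsFiniteMeasure (μ i a)] (hμ : ∀ i, Measurable (μ i)) :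
    Measurable fun a => Measure.pi fun i => μ i a := by
  refine Measurable.measure_of_isPiSystem (generateFrom_pi (α := fun _ : ι => E)).symm
    isPiSystem_pi ?_ ?_
  · rintro _ ⟨s, hs, rfl⟩
    simp only [Measure.pi_pi]
    exact Finset.measurable_prod _ fun i _ =>
      (Measure.measurable_coe (hs i (Set.mem_univ i))).comp (hμ i)
  · simp only [Measure.pi_univ]
    exact Finset.measurable_prod _ fun i _ =>
      (Measure.measurable_coe MeasurableSet.univ).comp (hμ i)

/-- Independent draws: given `a`, the coordinates are independent and the `i`-th one has
law `κ i a`. -/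
def piKernel {α E ι : Type*} [MeasurableSpace α] [MeasurableSpace E] [Fintype ι]
    (κ : ι → Kernel α E) [∀ i a, IsFiniteMeasure (κ i a)] : Kernel α (ι → E) where
  toFun a := Measure.pi fun i => κ i a
  measurable' := measurable_pi_measure (fun i a => κ i a) fun i => (κ i).measurable

instance {α E ι : Type*} [MeasurableSpace α] [MeasurableSpace E] [Fintype ι]
    (κ : ι → Kernel α E) [∀ i a, IsFiniteMeasure (κ i a)] (a : α) :
    IsFiniteMeasure (piKernel κ a) :=
  inferInstanceAs (IsFiniteMeasure (Measure.pi fun i => κ i a))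

/-- The normalised weights `w l / ∑ j, w j`. -/
def normWeight {N : ℕ} (w : Fin N → ℝ) (l : Fin N) : ℝ := w l / ∑ j, w j

/-- Given `a`, the categorical distribution on the index set with probabilities proportional
to `w a`. -/
def catKernel {α : Type*} [MeasurableSpace α] {N : ℕ} (w : α → Fin N → ℝ) (hw : Measurable w) :
    Kernel α (Fin N) where
  toFun a := ∑ l, ENNReal.ofReal (normWeight (w a) l) • Measure.dirac l
  measurable' := by
    have hl : ∀ l, Measurable fun a => w a l := fun l => (measurable_pi_apply l).comp hw
    refine Measure.measurable_of_measurable_coe _ fun s _ => ?_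
    simp only [Measure.coe_finsetSum, Finset.sum_apply, Measure.smul_apply, smul_eq_mul]
    refine Finset.measurable_sum _ fun l _ => Measurable.mul_const ?_ _
    exact ((hl l).div (Finset.measurable_sum _ fun j _ => hl j)).ennreal_ofReal

instance {α : Type*} [MeasurableSpace α] {N : ℕ} (w : α → Fin N → ℝ) (hw : Measurable w) (a : α) :
    IsFiniteMeasure (catKernel w hw a) := by
  change IsFiniteMeasure (∑ l, ENNReal.ofReal (normWeight (w a) l) • Measure.dirac l)
  refine ⟨?_⟩
  simp [Measure.coe_finsetSum]

/-! ### The Feynman-Kac model -/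

/-- The data of the model: the initial law `M₀`, the Markov kernels (`trans t` is the transition
`M_{t+1}` from time `t` to time `t + 1`), the non-negative potentials `g_t`, and the reference
measure `ν` with the (candidate) densities of `M₀` and of `M_{t+1}`
(`dens t x' x = m_{t+1}(x', x)`). -/
structure Model (X : Type*) [MeasurableSpace X] where
  init : Measure X
  trans : ℕ → Kernel X X
  pot : ℕ → X → ℝ
  ν : Measure X
  dens₀ : X → ℝ
  dens : ℕ → X → X → ℝ
  isProbabilityMeasure_init : IsProbabilityMeasure init
  isMarkovKernel_trans : ∀ t, IsMarkovKernel (trans t)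
  measurable_pot : ∀ t, Measurable (pot t)
  pot_nonneg : ∀ t x, 0 ≤ pot t x
  measurable_dens₀ : Measurable dens₀
  dens₀_nonneg : ∀ x, 0 ≤ dens₀ x
  measurable_dens : ∀ t, Measurable (Function.uncurry (dens t))
  dens_nonneg : ∀ t x' x, 0 ≤ dens t x' x

attribute [instance] Model.isProbabilityMeasure_init Model.isMarkovKernel_trans

namespace Model

variable {X : Type*} [MeasurableSpace X] (F : Model X)

/-- The initial law and the transitions have the given densities with respect to `ν`. -/
def HasDensities : Prop :=
  F.init = F.ν.withDensity (fun x => ENNReal.ofReal (F.dens₀ x)) ∧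
    ∀ t x', F.trans t x' = F.ν.withDensity fun x => ENNReal.ofReal (F.dens t x' x)

/-- The potentials are positive and bounded, uniformly in time. -/
def PotentialsPosBounded : Prop :=
  ∃ G : ℝ, 0 < G ∧ ∀ t x, 0 < F.pot t x ∧ F.pot t x ≤ G

/-- The transition densities are positive. -/
def DensitiesPos : Prop := ∀ t x' x, 0 < F.dens t x' x

/-- The transition densities are bounded above, uniformly in time. -/
def DensitiesBounded : Prop := ∃ σ : ℝ, 0 < σ ∧ ∀ t x' x, F.dens t x' x ≤ σ

/-- The unnormalised kernel `Q_{t+1}(x, dy) = g_t(x) M_{t+1}(x, dy)`. -/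
def Q (t : ℕ) : Kernel X X :=
  (F.trans t).withDensity fun x _ => ENNReal.ofReal (F.pot t x)

/-- `Qmarg s n` is the marginal of `Q_{s+1} ⊗ ⋯ ⊗ Q_{s+n}` in its last variable, that is the
composed kernel from time `s` to time `s + n`; it is the identity for `n = 0`. -/
def Qmarg (s : ℕ) : ℕ → Kernel X X
  | 0 => Kernel.id
  | n + 1 => F.Q (s + n) ∘ₖ Qmarg s n

/-- The unnormalised marginal measures `γ_t`: `γ_0 = M_0` and `γ_{t+1} = γ_t Q_{t+1}`. -/
def γ : ℕ → Measure X
  | 0 => F.init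
  | t + 1 => F.Q t ∘ₘ γ t

/-- The asymptotic variance
`∑_{s=0}^t { γ_s(1) γ_s((Q_{s+1:t}[h])²) - γ_t(h)² }`. -/
def asymptVar (t : ℕ) (h : X → ℝ) : ℝ :=
  ∑ s ∈ Finset.range (t + 1),
    ((∫ _, 1 ∂F.γ s) * (∫ x, (∫ y, h y ∂F.Qmarg s (t - s) x) ^ 2 ∂F.γ s)
      - (∫ x, h x ∂F.γ t) ^ 2)

end Model

/-! ### Runs of the particle filter with backward indices -/

/-- The random variables drawn when going from time `t` to time `t + 1`: the ancestor indices
`A_t^i`, the new particles `ξ_{t+1}^i` and the backward indices `J^i_{k,t}`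
(written `J k i`). -/
abbrev Move (X : Type*) (N M : ℕ) : Type _ :=
  (Fin N → Fin N) × (Fin N → X) × (Fin N → Fin M → Fin N)

/-- A run of the algorithm up to time `t`: the initial particles, followed by `t` moves. -/
def Run (X : Type*) (N M : ℕ) : ℕ → Type _
  | 0 => Fin N → X
  | t + 1 => Run X N M t × Move X N M

instance Run.instMeasurableSpace (X : Type*) [MeasurableSpace X] (N M : ℕ) :
    ∀ t, MeasurableSpace (Run X N M t)
  | 0 => inferInstanceAs (MeasurableSpace (Fin N → X))
  | t + 1 =>
    letI := Run.instMeasurableSpace X N M t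
    inferInstanceAs (MeasurableSpace (Run X N M t × Move X N M))

/-- The particles `ξ_t^1, …, ξ_t^N` at the final time of a run. -/
def Run.particles {X : Type*} {N M : ℕ} : ∀ {t : ℕ}, Run X N M t → Fin N → X
  | 0, z => z
  | _ + 1, (_, _, ξ, _) => ξ

theorem Run.measurable_particles {X : Type*} [MeasurableSpace X] {N M : ℕ} :
    ∀ t, Measurable (Run.particles : Run X N M t → Fin N → X)
  | 0 => measurable_id
  | t + 1 => by
    change Measurable fun z : Run X N M t × Move X N M => z.2.2.1
    fun_prop

namespace Model

variable {X : Type*} [MeasurableSpace X] (F : Model X) {N M : ℕ}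

/-- The importance weights `ω_t^i = g_t(ξ_t^i)`. -/
def weight (t : ℕ) (ξ : Fin N → X) (i : Fin N) : ℝ := F.pot t (ξ i)

theorem measurable_weight (t : ℕ) :
    Measurable (F.weight t : (Fin N → X) → Fin N → ℝ) :=
  measurable_pi_lambda _ fun i => (F.measurable_pot t).comp (measurable_pi_apply i)

/-- The unnormalised backward weights `ω_t^l m_{t+1}(ξ_t^l, x)`, for `ξ` the particles at
time `t`. -/
def backWeight (t : ℕ) (ξ : Fin N → X) (x : X) (l : Fin N) : ℝ :=
  F.weight t ξ l * F.dens t (ξ l) x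

/-- Selection: given the particles at time `t`, the ancestor indices are i.i.d. with
probabilities proportional to the importance weights. -/
def selectKernel (N t : ℕ) : Kernel (Fin N → X) (Fin N → Fin N) :=
  piKernel fun _ : Fin N => catKernel (F.weight t) (F.measurable_weight t)

theorem measurable_ancestor (i : Fin N) :
    Measurable fun p : (Fin N → X) × (Fin N → Fin N) => p.1 (p.2 i) := by
  have h : Measurable fun q : (Fin N → X) × Fin N => q.1 q.2 :=
    measurable_from_prod_countable_left fun l => measurable_pi_apply l
  exact h.comp (measurable_fst.prodMk ((measurable_pi_apply i).comp measurable_snd))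

/-- Mutation: given the particles at time `t` and the ancestor indices, the particles at time
`t + 1` are independent and `ξ_{t+1}^i` has law `M_{t+1}(ξ_t^{A_t^i}, ·)`. -/
def mutateKernel (N t : ℕ) : Kernel ((Fin N → X) × (Fin N → Fin N)) (Fin N → X) :=
  piKernel fun i : Fin N =>
    (F.trans t).comap (fun p : (Fin N → X) × (Fin N → Fin N) => p.1 (p.2 i)) (measurable_ancestor i)

theorem measurable_backWeight (t : ℕ) (k : Fin N) :
    Measurable fun p : ((Fin N → X) × (Fin N → Fin N)) × (Fin N → X) =>
      F.backWeight t p.1.1 (p.2 k) := by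
  refine measurable_pi_lambda _ fun l => Measurable.mul ?_ ?_
  · exact (F.measurable_pot t).comp
      ((measurable_pi_apply l).comp (measurable_fst.comp measurable_fst))
  · have h₁ : Measurable fun p : ((Fin N → X) × (Fin N → Fin N)) × (Fin N → X) => p.1.1 l :=
      (measurable_pi_apply l).comp (measurable_fst.comp measurable_fst)
    have h₂ : Measurable fun p : ((Fin N → X) × (Fin N → Fin N)) × (Fin N → X) => p.2 k :=
      (measurable_pi_apply k).comp measurable_snd
    exact (F.measurable_dens t).comp (h₁.prodMk h₂)

/-- One vector `J_{k,t}^{1:M}` of backward indices: i.i.d. draws from the backward weights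
of the particle `ξ_{t+1}^k`. -/
def backRowKernel (N M t : ℕ) (k : Fin N) :
    Kernel (((Fin N → X) × (Fin N → Fin N)) × (Fin N → X)) (Fin M → Fin N) :=
  piKernel fun _ : Fin M =>
    catKernel (fun p => F.backWeight t p.1.1 (p.2 k)) (F.measurable_backWeight t k)

instance (N M t : ℕ) (k : Fin N) (p : ((Fin N → X) × (Fin N → Fin N)) × (Fin N → X)) :
    IsFiniteMeasure (F.backRowKernel N M t k p) := by
  unfold backRowKernel
  infer_instance

/-- Backward sampling: given all particles at times `t` and `t + 1`, the vectors
`J_{k,t}^{1:M}`, for `k` in `[N]`, are independent. -/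
def backKernel (N M t : ℕ) :
    Kernel (((Fin N → X) × (Fin N → Fin N)) × (Fin N → X)) (Fin N → Fin M → Fin N) :=
  piKernel fun k : Fin N => F.backRowKernel N M t k

/-- One step of the algorithm: selection, then mutation, then backward sampling. -/
def stepKernel (N M t : ℕ) : Kernel (Fin N → X) (Move X N M) :=
  F.selectKernel N t ⊗ₖ (F.mutateKernel N t ⊗ₖ F.backKernel N M t)

/-- The law of the run of the algorithm with `N` particles and `M` backward indices, up to a
given time. -/
def runLaw (N M : ℕ) : ∀ t, Measure (Run X N M t)
  | 0 => (Measure.pi fun _ => F.init : Measure (Fin N → X))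
  | t + 1 =>
    (runLaw N M t ⊗ₘ (F.stepKernel N M t).comap Run.particles (Run.measurable_particles t) :
      Measure (Run X N M t × Move X N M))

/-! ### The estimators, as functions of the run -/

/-- The product `∏_{s=0}^{t-1} N⁻¹ Ω_s`, where `Ω_s = ∑_i ω_s^i`. -/
def weightProd : ∀ {t : ℕ}, Run X N M t → ℝ
  | 0, _ => 1
  | t + 1, (z, _) => weightProd z * ((N : ℝ)⁻¹ * ∑ i, F.weight t z.particles i)

/-- The empirical predictive measure `η_t^N(h) = N⁻¹ ∑_i h(ξ_t^i)`. -/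
def etaN {t : ℕ} (z : Run X N M t) (h : X → ℝ) : ℝ := (N : ℝ)⁻¹ * ∑ i, h (z.particles i)

/-- The particle approximation `γ_t^N(h) = {∏_{s=0}^{t-1} N⁻¹ Ω_s} η_t^N(h)`. -/
def gammaN {t : ℕ} (z : Run X N M t) (h : X → ℝ) : ℝ := F.weightProd z * etaN z h

/-- The sampled coalescence statistics `𝒯̃_t^b(k, l)`, for `b ∈ {0,1}^{t+1}`. -/
def coalStat : ∀ {t : ℕ}, Run X N M t → (Fin (t + 1) → Fin 2) → Fin N → Fin N → ℝ
  | 0, _, b, k, l =>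
    if b 0 = 0 then (if k ≠ l then 1 else 0) else (if k = l then 1 else 0)
  | t + 1, (z, _, _, J), b, k, l =>
    if b (Fin.last (t + 1)) = 0 then
      (if k ≠ l then
        (M : ℝ)⁻¹ * ∑ i, coalStat z (fun s => b s.castSucc) (J k i) (J l i)
      else 0)
    else
      (if k = l then
        (M : ℝ)⁻¹ * ∑ i, ∑ j, normWeight (F.weight t z.particles) j *
          coalStat z (fun s => b s.castSucc) (J k i) j
      else 0)

/-- The estimator
`{∏_{s=0}^t N^{b_s} (N/(N-1))^{1-b_s}} γ_t^N(1)² N⁻² ∑_{i,j} 𝒯̃_t^b(i,j) f(ξ_t^i, ξ_t^j)`. -/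
def muEst {t : ℕ} (z : Run X N M t) (b : Fin (t + 1) → Fin 2) (f : X → X → ℝ) : ℝ :=
  (∏ s, if b s = 0 then (N : ℝ) / ((N : ℝ) - 1) else (N : ℝ)) *
    (F.gammaN z (fun _ => 1) ^ 2 / (N : ℝ) ^ 2) *
      ∑ i, ∑ j, F.coalStat z b i j * f (z.particles i) (z.particles j)

/-- The variance estimator `N (γ_t^N(h)² - γ̃_{0,t}(h ⊗ h))`, where `γ̃_{0,t}` is the
estimator `muEst` for `b = (0, …, 0)`. -/
def varEst {t : ℕ} (z : Run X N M t) (h : X → ℝ) : ℝ :=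
  (N : ℝ) * (F.gammaN z h ^ 2 - F.muEst z 0 fun x y => h x * h y)

end Model

end Paris

end

/-! Write `pairEst z b φ ψ` for the second-order estimator without its powers of N. The coalescence
statistics sum to one over b (`sum_coalStat`), so the `pairEst` sum to γ_t^N(φ) γ_t^N(ψ)
(`sum_pairEst`). Hence (`varEst_eq`) the variance estimator is N(1 - (N/(N-1))^{t+1}) times
`pairEst` at b = 0, plus N times the sum of `pairEst` over b ≠ 0. The deterministic factor tends to
-(t+1), and `pairEst` at b = 0 tends to γ_t(h)². For b ≠ 0, N times `pairEst` tends to γ_s(1)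
γ_s(Q_{s+1:t}[h]²) if b has a single one, at s, and to 0 if it has several. These limits add up to
the asymptotic variance.

The limit for b ≠ 0 is an induction on time (`meanLim_mul_pairEst`). The backward weights are the
posterior weights of the ancestor, so, given the particles at time t and for a fixed i, the pairs
(ξ_{t+1}^k, J_{k,t}^i) are i.i.d. with the law of a particle and its ancestor (`map_stepKernel`).
The conditional mean of `pairEst` is therefore again a `pairEst`, one time earlier: (1 - 1/N) times
the one at (Qφ, Qψ) if the last bit is 0, and 1/N times the one at (Q(φψ), Q1) if it is 1. Different
i share the same new particles, but every statistic is an average over i, so Jensen's inequality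
reduces second moments to a single index.

For the fluctuations, the summands over (k, l) are uncorrelated for disjoint pairs, so the
conditional variance is controlled by the squared row sums of the coalescence statistics
(`integral_sq_sub_le_of_disjoint_uncorrelated`). For b ≠ 0 the mean of `rowMoment` is O(N) and that
of `pairEst` at (1, 1) is O(1/N). One step thus adds a variance O(N⁻³), which is negligible after
multiplication by N. The powers of `weightProd` carried by these moments cancel the denominators of
the normalised weights, so no lower bound on the potentials enters. All limits are taken in mean;
Markov's inequality then gives convergence in probability using only the laws of the runs. -/

noncomputable section

namespace Paris

/-! ### Bounded measurable functions -/

/-- Bounded measurable real functions. -/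
structure BddMeas {α : Type*} [MeasurableSpace α] (f : α → ℝ) : Prop where
  meas : Measurable f
  bdd : ∃ C : ℝ, ∀ x, |f x| ≤ C

namespace BddMeas

variable {α β : Type*} [MeasurableSpace α] [MeasurableSpace β] {f g : α → ℝ}

theorem const (c : ℝ) : BddMeas fun _ : α => c := ⟨measurable_const, |c|, fun _ => le_rfl⟩

theorem add (hf : BddMeas f) (hg : BddMeas g) : BddMeas fun x => f x + g x := by
  obtain ⟨C, hC⟩ := hf.bdd
  obtain ⟨D, hD⟩ := hg.bdd
  exact ⟨hf.meas.add hg.meas, C + D, fun x => (abs_add_le _ _).trans (add_le_add (hC x) (hD x))⟩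

theorem mul (hf : BddMeas f) (hg : BddMeas g) : BddMeas fun x => f x * g x := by
  obtain ⟨C, hC⟩ := hf.bdd
  obtain ⟨D, hD⟩ := hg.bdd
  refine ⟨hf.meas.mul hg.meas, C * D, fun x => ?_⟩
  rw [abs_mul]
  exact mul_le_mul (hC x) (hD x) (abs_nonneg _) ((abs_nonneg _).trans (hC x))

theorem sub (hf : BddMeas f) (hg : BddMeas g) : BddMeas fun x => f x - g x := by
  simpa [sub_eq_add_neg] using hf.add ((const (-1)).mul hg)

theorem const_mul (c : ℝ) (hf : BddMeas f) : BddMeas fun x => c * f x := (const c).mul hf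

theorem pow (hf : BddMeas f) (n : ℕ) : BddMeas fun x => f x ^ n := by
  induction n with
  | zero => simpa using const (α := α) 1
  | succ n ih => simpa [pow_succ] using ih.mul hf

theorem abs (hf : BddMeas f) : BddMeas fun x => |f x| := by
  obtain ⟨C, hC⟩ := hf.bdd
  exact ⟨hf.meas.abs, C, fun x => by rw [abs_abs]; exact hC x⟩

theorem sum {ι : Type*} {s : Finset ι} {f : ι → α → ℝ} (hf : ∀ i, BddMeas (f i)) :
    BddMeas fun x => ∑ i ∈ s, f i x := by
  classical
  induction s using Finset.induction_on with
  | empty => simpa using const (α := α) 0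
  | insert i s hi ih => simpa [Finset.sum_insert hi] using (hf i).add ih

theorem comp (hf : BddMeas f) {u : β → α} (hu : Measurable u) : BddMeas fun x => f (u x) :=
  ⟨hf.meas.comp hu, hf.bdd.imp fun _ hC x => hC (u x)⟩

theorem ite_const (p : Prop) [Decidable p] (hf : BddMeas f) (hg : BddMeas g) :
    BddMeas fun x => if p then f x else g x := by
  split_ifs <;> assumption

theorem of_finite [Finite α] [DiscreteMeasurableSpace α] (f : α → ℝ) : BddMeas f := by
  obtain ⟨C, hC⟩ := (Set.finite_range fun x => |f x|).bddAbove
  exact ⟨Measurable.of_discrete, C, fun x => hC ⟨x, rfl⟩⟩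

theorem integrable (hf : BddMeas f) (μ : Measure α) [IsFiniteMeasure μ] : Integrable f μ := by
  obtain ⟨C, hC⟩ := hf.bdd
  exact Integrable.of_bound hf.meas.aestronglyMeasurable C (ae_of_all _ hC)

theorem integral_kernel {f : α × β → ℝ} (hf : BddMeas f) (κ : Kernel α β) [IsMarkovKernel κ] :
    BddMeas fun a => ∫ b, f (a, b) ∂κ a := by
  obtain ⟨C, hC⟩ := hf.bdd
  refine ⟨(hf.meas.stronglyMeasurable.integral_kernel_prod_right' (κ := κ)).measurable, C,
    fun a => ?_⟩
  have := norm_integral_le_of_norm_le_const (μ := κ a) (f := fun b => f (a, b))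
    (ae_of_all _ fun b => hC (a, b))
  simpa using this

theorem integral_compProd {f : α × β → ℝ} (hf : BddMeas f) (μ : Measure α) [IsProbabilityMeasure μ]
    (κ : Kernel α β) [IsMarkovKernel κ] :
    ∫ x, f x ∂(μ ⊗ₘ κ) = ∫ a, ∫ b, f (a, b) ∂κ a ∂μ :=
  Measure.integral_compProd (hf.integrable _)

end BddMeas

theorem integral_le_of_bddMeas {α : Type*} [MeasurableSpace α] {f g : α → ℝ} (hf : BddMeas f)
    (hg : BddMeas g) (μ : Measure α) [IsFiniteMeasure μ] (h : ∀ x, f x ≤ g x) :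
    ∫ x, f x ∂μ ≤ ∫ x, g x ∂μ :=
  integral_mono (hf.integrable μ) (hg.integrable μ) h

theorem integral_sum_of_bddMeas {α ι : Type*} [MeasurableSpace α] (s : Finset ι) {f : ι → α → ℝ}
    (hf : ∀ i, BddMeas (f i)) (μ : Measure α) [IsFiniteMeasure μ] :
    ∫ x, ∑ i ∈ s, f i x ∂μ = ∑ i ∈ s, ∫ x, f i x ∂μ :=
  integral_finsetSum _ fun i _ => (hf i).integrable μ

theorem sq_integral_le {α : Type*} [MeasurableSpace α] {f : α → ℝ} (hf : BddMeas f)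
    (μ : Measure α) [IsProbabilityMeasure μ] : (∫ x, f x ∂μ) ^ 2 ≤ ∫ x, f x ^ 2 ∂μ := by
  set m := ∫ x, f x ∂μ with hm
  have h1 : ∫ x, (f x ^ 2 - 2 * m * f x + m ^ 2) ∂μ = ∫ x, f x ^ 2 ∂μ - 2 * m * m + m ^ 2 := by
    rw [integral_add (((hf.pow 2).sub (hf.const_mul (2 * m))).integrable μ) (integrable_const _),
      integral_sub ((hf.pow 2).integrable μ) ((hf.const_mul (2 * m)).integrable μ),
      integral_const_mul, ← hm]
    simp
  have h2 : 0 ≤ ∫ x, (f x ^ 2 - 2 * m * f x + m ^ 2) ∂μ :=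
    integral_nonneg fun x => by
      change (0 : ℝ) ≤ f x ^ 2 - 2 * m * f x + m ^ 2
      nlinarith [sq_nonneg (f x - m)]
  nlinarith

theorem integral_abs_le_sqrt {α : Type*} [MeasurableSpace α] {f : α → ℝ} (hf : BddMeas f)
    (μ : Measure α) [IsProbabilityMeasure μ] : ∫ x, |f x| ∂μ ≤ √(∫ x, f x ^ 2 ∂μ) := by
  refine Real.le_sqrt_of_sq_le ?_
  simpa using sq_integral_le hf.abs μ

/-! ### A variance bound for sums with local dependence -/

/-- If `X k l` and `X k' l'` are uncorrelated as soon as `{k, l}` and `{k', l'}` are disjoint, the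
variance of `∑ X k l` is controlled by the second moment of the row sums of a dominating symmetric
array. -/
theorem integral_sq_sub_le_of_disjoint_uncorrelated {Ω ι : Type*} [MeasurableSpace Ω]
    [Fintype ι] (P : Measure Ω) [IsProbabilityMeasure P]
    {X T : ι → ι → Ω → ℝ} (hX : ∀ k l, BddMeas (X k l)) (hT : ∀ k l, BddMeas (T k l)) {C : ℝ}
    (hXT : ∀ k l ω, |X k l ω| ≤ C * T k l ω) (hC : 0 ≤ C) (hT0 : ∀ k l ω, 0 ≤ T k l ω)
    (hsymm : ∀ k l ω, T k l ω = T l k ω)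
    (hcov : ∀ k l k' l', k ≠ k' → k ≠ l' → l ≠ k' → l ≠ l' →
      ∫ ω, X k l ω * X k' l' ω ∂P = (∫ ω, X k l ω ∂P) * ∫ ω, X k' l' ω ∂P) :
    ∫ ω, (∑ k, ∑ l, X k l ω - ∫ ω', ∑ k, ∑ l, X k l ω' ∂P) ^ 2 ∂P
      ≤ 8 * C ^ 2 * ∫ ω, ∑ k, (∑ l, T k l ω) ^ 2 ∂P := by
  classical
  set e : ι → ι → ℝ := fun k l => ∫ ω, X k l ω ∂P with he
  set f : ι → ι → ℝ := fun k l => ∫ ω, T k l ω ∂P with hf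
  -- A bound for the covariance of two entries: the mean of the product and the product of the means
  -- are dominated separately.
  set D : ι → ι → ι → ι → ℝ := fun k l k' l' =>
    C ^ 2 * (∫ ω, T k l ω * T k' l' ω ∂P + f k l * f k' l') with hD
  have hf0 : ∀ k l, 0 ≤ f k l := fun k l => integral_nonneg fun ω => hT0 k l ω
  have hD0 : ∀ k l k' l', 0 ≤ D k l k' l' := fun k l k' l' => by
    refine mul_nonneg (sq_nonneg C) (add_nonneg (integral_nonneg fun ω => ?_) ?_)
    · exact mul_nonneg (hT0 _ _ _) (hT0 _ _ _)
    · exact mul_nonneg (hf0 _ _) (hf0 _ _)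
  have hsf : ∀ k l, f k l = f l k := fun k l => by simp only [hf, hsymm k l]
  have hDl : ∀ k l k' l', D k l k' l' = D l k k' l' := fun k l k' l' => by
    simp only [hD, hsf k l, hsymm k l]
  have hDr : ∀ k l k' l', D k l k' l' = D k l l' k' := fun k l k' l' => by
    simp only [hD, hsf k' l', hsymm k' l']
  have hcov_eq : ∀ k l k' l', ∫ ω, (X k l ω - e k l) * (X k' l' ω - e k' l') ∂P
      = ∫ ω, X k l ω * X k' l' ω ∂P - e k l * e k' l' := fun k l k' l' => by
    have h1 : ∀ ω, (X k l ω - e k l) * (X k' l' ω - e k' l')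
        = X k l ω * X k' l' ω - (e k l * X k' l' ω + e k' l' * X k l ω - e k l * e k' l') :=
      fun ω => by ring
    simp_rw [h1]
    rw [integral_sub (((hX k l).mul (hX k' l')).integrable P)
      (((((hX k' l').const_mul _).add ((hX k l).const_mul _)).sub (BddMeas.const _)).integrable P),
      integral_sub ((((hX k' l').const_mul _).add ((hX k l).const_mul _)).integrable P)
        (integrable_const _),
      integral_add (((hX k' l').const_mul _).integrable P) (((hX k l).const_mul _).integrable P),
      integral_const_mul, integral_const_mul]
    simp only [integral_const, probReal_univ, smul_eq_mul, one_mul, he]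
    ring
  have habs : ∀ k l, |e k l| ≤ C * f k l := fun k l => by
    refine (abs_integral_le_integral_abs).trans ?_
    rw [hf, ← integral_const_mul]
    exact integral_le_of_bddMeas (hX k l).abs ((hT k l).const_mul C) P (hXT k l)
  have hcovD : ∀ k l k' l', ∫ ω, (X k l ω - e k l) * (X k' l' ω - e k' l') ∂P ≤ D k l k' l' := by
    intro k l k' l'
    rw [hcov_eq, hD]
    have h1 : ∫ ω, X k l ω * X k' l' ω ∂P ≤ C ^ 2 * ∫ ω, T k l ω * T k' l' ω ∂P := by
      rw [← integral_const_mul]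
      refine integral_le_of_bddMeas ((hX k l).mul (hX k' l'))
        (((hT k l).mul (hT k' l')).const_mul _) P fun ω => ?_
      calc X k l ω * X k' l' ω ≤ |X k l ω| * |X k' l' ω| := by
            rw [← abs_mul]; exact le_abs_self _
        _ ≤ (C * T k l ω) * (C * T k' l' ω) :=
            mul_le_mul (hXT _ _ _) (hXT _ _ _) (abs_nonneg _) (mul_nonneg hC (hT0 _ _ _))
        _ = _ := by ring
    have h2 : -(e k l * e k' l') ≤ C ^ 2 * (f k l * f k' l') := by
      calc -(e k l * e k' l') ≤ |e k l| * |e k' l'| := by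
            rw [← abs_mul]; exact neg_le_abs _
        _ ≤ (C * f k l) * (C * f k' l') :=
            mul_le_mul (habs _ _) (habs _ _) (abs_nonneg _) (mul_nonneg hC (hf0 _ _))
        _ = _ := by ring
    linarith
  -- One indicator for each way in which the two pairs can meet. Multiple coincidences are
  -- overcounted, harmlessly since `D` is non-negative.
  have hbound : ∀ k l k' l', ∫ ω, (X k l ω - e k l) * (X k' l' ω - e k' l') ∂P
      ≤ (if k = k' then D k l k' l' else 0) + (if k = l' then D k l k' l' else 0)
        + (if l = k' then D k l k' l' else 0) + (if l = l' then D k l k' l' else 0) := by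
    intro k l k' l'
    have h0 := hD0 k l k' l'
    have h1 := hcovD k l k' l'
    have g : ∀ (p : Prop) [Decidable p], 0 ≤ if p then D k l k' l' else 0 := fun p _ => by
      split_ifs <;> simp [h0]
    by_cases hov : k = k' ∨ k = l' ∨ l = k' ∨ l = l'
    · have g1 := g (k = k')
      have g2 := g (k = l')
      have g3 := g (l = k')
      have g4 := g (l = l')
      rcases hov with h | h | h | h
      · have h2 : (if k = k' then D k l k' l' else 0) = D k l k' l' := if_pos h
        linarith
      · have h2 : (if k = l' then D k l k' l' else 0) = D k l k' l' := if_pos h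
        linarith
      · have h2 : (if l = k' then D k l k' l' else 0) = D k l k' l' := if_pos h
        linarith
      · have h2 : (if l = l' then D k l k' l' else 0) = D k l k' l' := if_pos h
        linarith
    · push Not at hov
      obtain ⟨a1, a2, a3, a4⟩ := hov
      have h2 := hcov k l k' l' a1 a2 a3 a4
      have h3 := hcov_eq k l k' l'
      rw [if_neg a1, if_neg a2, if_neg a3, if_neg a4, h3, h2]
      simp [he]
  -- The contribution of pairs with the same first index. By the symmetries of `D` the four kinds of
  -- overlap contribute equally, hence 4B. Each half of `D` costs at most one row moment, the second
  -- because a squared mean is at most the mean square; this gives the constant 8.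
  set B : ℝ := ∑ k, ∑ l, ∑ l', D k l k l' with hB
  have hB_le : B ≤ 2 * C ^ 2 * ∫ ω, ∑ k, (∑ l, T k l ω) ^ 2 ∂P := by
    have h1 : ∀ k, ∑ l, ∑ l', D k l k l'
        = C ^ 2 * (∫ ω, (∑ l, T k l ω) ^ 2 ∂P + (∫ ω, ∑ l, T k l ω ∂P) ^ 2) := by
      intro k
      rw [integral_sum_of_bddMeas _ (fun l => hT k l)]
      simp only [pow_two (∑ _, _), Finset.sum_mul_sum]
      rw [integral_sum_of_bddMeas _ (fun l => BddMeas.sum fun l' => (hT k l).mul (hT k l')),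
        ← Finset.sum_add_distrib, Finset.mul_sum]
      refine Finset.sum_congr rfl fun l _ => ?_
      rw [integral_sum_of_bddMeas _ (fun l' => (hT k l).mul (hT k l')),
        ← Finset.sum_add_distrib, Finset.mul_sum]
    rw [hB, integral_sum_of_bddMeas _ fun k => (BddMeas.sum fun l => hT k l).pow 2, Finset.mul_sum]
    refine Finset.sum_le_sum fun k _ => ?_
    rw [h1]
    have h2 := sq_integral_le (BddMeas.sum (s := Finset.univ) fun l => hT k l) P
    nlinarith [sq_nonneg C]
  have hS : ∀ ω, (∑ k, ∑ l, X k l ω - ∫ ω', ∑ k, ∑ l, X k l ω' ∂P) ^ 2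
      = ∑ k, ∑ l, ∑ k', ∑ l', (X k l ω - e k l) * (X k' l' ω - e k' l') := by
    intro ω
    rw [integral_sum_of_bddMeas _ fun k => BddMeas.sum fun l => hX k l]
    simp_rw [integral_sum_of_bddMeas _ fun l => hX _ l]
    rw [← Finset.sum_sub_distrib]
    simp_rw [← Finset.sum_sub_distrib, ← Finset.mul_sum, ← Finset.sum_mul]
    rw [pow_two]
  have hX' : ∀ k l, BddMeas fun ω => X k l ω - e k l := fun k l => (hX k l).sub (BddMeas.const _)
  have hI : ∫ ω, (∑ k, ∑ l, X k l ω - ∫ ω', ∑ k, ∑ l, X k l ω' ∂P) ^ 2 ∂P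
      = ∑ k, ∑ l, ∑ k', ∑ l', ∫ ω, (X k l ω - e k l) * (X k' l' ω - e k' l') ∂P := by
    simp_rw [hS]
    rw [integral_sum_of_bddMeas _ fun k => BddMeas.sum fun l => BddMeas.sum fun k' =>
      BddMeas.sum fun l' => (hX' k l).mul (hX' k' l')]
    refine Finset.sum_congr rfl fun k _ => ?_
    rw [integral_sum_of_bddMeas _ fun l => BddMeas.sum fun k' =>
      BddMeas.sum fun l' => (hX' k l).mul (hX' k' l')]
    refine Finset.sum_congr rfl fun l _ => ?_
    rw [integral_sum_of_bddMeas _ fun k' => BddMeas.sum fun l' => (hX' k l).mul (hX' k' l')]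
    refine Finset.sum_congr rfl fun k' _ => ?_
    rw [integral_sum_of_bddMeas _ fun l' => (hX' k l).mul (hX' k' l')]
  have h4 : ∑ k, ∑ l, ∑ k', ∑ l', ((if k = k' then D k l k' l' else 0)
      + (if k = l' then D k l k' l' else 0) + (if l = k' then D k l k' l' else 0)
      + (if l = l' then D k l k' l' else 0)) = 4 * B := by
    simp only [Finset.sum_add_distrib]
    have e1 : ∑ k, ∑ l, ∑ k', ∑ l', (if k = k' then D k l k' l' else 0) = B := by
      refine Finset.sum_congr rfl fun k _ => Finset.sum_congr rfl fun l _ => ?_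
      rw [Finset.sum_comm]
      exact Finset.sum_congr rfl fun l' _ => by simp
    have e2 : ∑ k, ∑ l, ∑ k', ∑ l', (if k = l' then D k l k' l' else 0) = B := by
      refine Finset.sum_congr rfl fun k _ => Finset.sum_congr rfl fun l _ => ?_
      refine Finset.sum_congr rfl fun l' _ => ?_
      simp [hDr k l l' k]
    have e3 : ∑ k, ∑ l, ∑ k', ∑ l', (if l = k' then D k l k' l' else 0) = B := by
      rw [Finset.sum_comm]
      refine Finset.sum_congr rfl fun k _ => Finset.sum_congr rfl fun l _ => ?_
      rw [Finset.sum_comm]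
      exact Finset.sum_congr rfl fun l' _ => by simp [hDl l k k l']
    have e4 : ∑ k, ∑ l, ∑ k', ∑ l', (if l = l' then D k l k' l' else 0) = B := by
      rw [Finset.sum_comm]
      refine Finset.sum_congr rfl fun k _ => Finset.sum_congr rfl fun l _ => ?_
      exact Finset.sum_congr rfl fun l' _ => by simp [hDl l k, hDr k l l' k]
    rw [e1, e2, e3, e4]
    ring
  calc _ = _ := hI
    _ ≤ _ := Finset.sum_le_sum fun k _ => Finset.sum_le_sum fun l _ =>
        Finset.sum_le_sum fun k' _ => Finset.sum_le_sum fun l' _ => hbound k l k' l'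
    _ = 4 * B := h4
    _ ≤ _ := by linarith

/-! ### Integrals against product measures -/

theorem lintegral_pi_prod {ι E : Type*} [Fintype ι] [MeasurableSpace E] (μ : ι → Measure E)
    [∀ i, IsProbabilityMeasure (μ i)] {f : ι → E → ENNReal} (hf : ∀ i, Measurable (f i)) :
    ∫⁻ y, ∏ i, f i (y i) ∂Measure.pi μ = ∏ i, ∫⁻ x, f i x ∂μ i := by
  have h := lintegral_prod_eq_prod_lintegral_of_indepFun (μ := Measure.pi μ) Finset.univ
    (fun i y => f i (y i)) (iIndepFun_pi fun i => (hf i).aemeasurable)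
    (fun i => (hf i).comp (measurable_pi_apply i))
  rw [h]
  exact Finset.prod_congr rfl fun i _ =>
    (measurePreserving_eval μ i).lintegral_comp (hf i)

section Categorical

variable {α : Type*} [MeasurableSpace α] {N : ℕ}

theorem normWeight_nonneg {w : Fin N → ℝ} (hw : ∀ i, 0 ≤ w i) (l : Fin N) : 0 ≤ normWeight w l :=
  div_nonneg (hw l) (Finset.sum_nonneg fun i _ => hw i)

theorem sum_pos_of_pos [NeZero N] {w : Fin N → ℝ} (hw : ∀ i, 0 < w i) : 0 < ∑ i, w i :=
  Finset.sum_pos (fun i _ => hw i) Finset.univ_nonempty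

theorem sum_normWeight [NeZero N] {w : Fin N → ℝ} (hw : ∀ i, 0 < w i) :
    ∑ l, normWeight w l = 1 := by
  simp only [normWeight]
  rw [← Finset.sum_div, div_self (sum_pos_of_pos hw).ne']

theorem catKernel_apply {w : α → Fin N → ℝ} (hw : Measurable w) (a : α) :
    catKernel w hw a = ∑ l, ENNReal.ofReal (normWeight (w a) l) • Measure.dirac l := rfl

theorem isMarkovKernel_catKernel [NeZero N] {w : α → Fin N → ℝ} (hw : Measurable w)
    (hpos : ∀ a i, 0 < w a i) : IsMarkovKernel (catKernel w hw) := by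
  refine ⟨fun a => ⟨?_⟩⟩
  rw [catKernel_apply]
  simp only [Measure.coe_finsetSum, Finset.sum_apply, Measure.smul_apply, smul_eq_mul,
    measure_univ, mul_one]
  rw [← ENNReal.ofReal_sum_of_nonneg fun l _ => normWeight_nonneg (fun i => (hpos a i).le) l,
    sum_normWeight (hpos a), ENNReal.ofReal_one]

theorem lintegral_catKernel {w : α → Fin N → ℝ} (hw : Measurable w) (a : α)
    (f : Fin N → ENNReal) :
    ∫⁻ l, f l ∂catKernel w hw a = ∑ l, ENNReal.ofReal (normWeight (w a) l) * f l := by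
  rw [catKernel_apply]
  simp [lintegral_finsetSum_measure]

end Categorical

theorem piKernel_apply {α E ι : Type*} [MeasurableSpace α] [MeasurableSpace E] [Fintype ι]
    (κ : ι → Kernel α E) [∀ i a, IsFiniteMeasure (κ i a)] (a : α) :
    piKernel κ a = Measure.pi fun i => κ i a := rfl

theorem isMarkovKernel_piKernel {α E ι : Type*} [MeasurableSpace α] [MeasurableSpace E] [Fintype ι]
    (κ : ι → Kernel α E) [∀ i a, IsFiniteMeasure (κ i a)] (h : ∀ i, IsMarkovKernel (κ i)) :
    IsMarkovKernel (piKernel κ) :=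
  ⟨fun a => by rw [piKernel_apply]; infer_instance⟩

/-! ### The Markov kernels of the algorithm, and the law of a particle with a backward index -/

namespace Model

variable {X : Type*} [MeasurableSpace X]

theorem isMarkovKernel_mutateKernel (F : Model X) (N t : ℕ) :
    IsMarkovKernel (F.mutateKernel N t) :=
  isMarkovKernel_piKernel _ fun _ => inferInstance

/-- The standing assumptions, with an explicit bound `G ≥ 1` for the potentials. -/
structure Regular (F : Model X) (G : ℝ) : Prop where
  hasDensities : F.HasDensities
  dens_pos : F.DensitiesPos
  pot_pos : ∀ t x, 0 < F.pot t x
  pot_le : ∀ t x, F.pot t x ≤ G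
  one_le : 1 ≤ G

variable {F : Model X} {G : ℝ} {N : ℕ} (M t : ℕ)

namespace Regular

variable (hF : F.Regular G)
include hF

theorem weight_pos (ξ : Fin N → X) (i : Fin N) : 0 < F.weight t ξ i := hF.pot_pos t _

theorem backWeight_pos (ξ : Fin N → X) (x : X) (i : Fin N) : 0 < F.backWeight t ξ x i :=
  mul_pos (hF.weight_pos t ξ i) (hF.dens_pos t _ _)

variable [NeZero N]

theorem isMarkovKernel_selectKernel : IsMarkovKernel (F.selectKernel N t) :=
  isMarkovKernel_piKernel _ fun _ => isMarkovKernel_catKernel _ (hF.weight_pos t)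

theorem isMarkovKernel_backRowKernel (k : Fin N) : IsMarkovKernel (F.backRowKernel N M t k) :=
  isMarkovKernel_piKernel _ fun _ => isMarkovKernel_catKernel _ fun _ => hF.backWeight_pos t _ _

theorem isMarkovKernel_backKernel : IsMarkovKernel (F.backKernel N M t) :=
  isMarkovKernel_piKernel _ fun k => hF.isMarkovKernel_backRowKernel M t k

theorem isMarkovKernel_stepKernel : IsMarkovKernel (F.stepKernel N M t) := by
  have := hF.isMarkovKernel_selectKernel (N := N) t
  have := F.isMarkovKernel_mutateKernel N t
  have := hF.isMarkovKernel_backKernel (N := N) M t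
  unfold stepKernel
  infer_instance

theorem isProbabilityMeasure_runLaw : IsProbabilityMeasure (F.runLaw N M t) := by
  induction t with
  | zero => exact inferInstanceAs (IsProbabilityMeasure (Measure.pi fun _ => F.init))
  | succ t ih =>
    have := hF.isMarkovKernel_stepKernel (N := N) M t
    exact inferInstanceAs (IsProbabilityMeasure
      (F.runLaw N M t ⊗ₘ (F.stepKernel N M t).comap Run.particles (Run.measurable_particles t)))

end Regular

/-- The joint law of a particle at time `t + 1` and of its ancestor index. -/
def pairLaw (F : Model X) (t : ℕ) (ξ : Fin N → X) : Measure (X × Fin N) :=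
  ∑ l, ENNReal.ofReal (normWeight (F.weight t ξ) l) • (F.trans t (ξ l)).map fun x => (x, l)

theorem Regular.isProbabilityMeasure_pairLaw (hF : F.Regular G) [NeZero N] (ξ : Fin N → X) :
    IsProbabilityMeasure (F.pairLaw t ξ) := by
  refine ⟨?_⟩
  have h : ∀ l : Fin N, ((F.trans t (ξ l)).map fun x => (x, l)) Set.univ = 1 := fun l => by
    rw [Measure.map_apply measurable_prodMk_right MeasurableSet.univ]
    simp
  simp only [pairLaw, Measure.coe_finsetSum, Finset.sum_apply, Measure.smul_apply, smul_eq_mul, h,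
    mul_one]
  rw [← ENNReal.ofReal_sum_of_nonneg fun l _ =>
    normWeight_nonneg (fun i => (hF.weight_pos t ξ i).le) l,
    sum_normWeight (hF.weight_pos t ξ), ENNReal.ofReal_one]

theorem pairLaw_apply (ξ : Fin N → X) {s : Set (X × Fin N)} (hs : MeasurableSet s) :
    F.pairLaw t ξ s = ∑ l, ENNReal.ofReal (normWeight (F.weight t ξ) l)
      * F.trans t (ξ l) ((fun x => (x, l)) ⁻¹' s) := by
  simp only [pairLaw, Measure.coe_finsetSum, Finset.sum_apply, Measure.smul_apply, smul_eq_mul]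
  exact Finset.sum_congr rfl fun l _ => by rw [Measure.map_apply measurable_prodMk_right hs]

theorem integral_pairLaw (ξ : Fin N → X) {f : X × Fin N → ℝ} (hf : BddMeas f)
    (hw : ∀ i, 0 ≤ F.weight t ξ i) :
    ∫ y, f y ∂F.pairLaw t ξ
      = ∑ l, normWeight (F.weight t ξ) l * ∫ x, f (x, l) ∂F.trans t (ξ l) := by
  rw [pairLaw, integral_finsetSum_measure]
  · refine Finset.sum_congr rfl fun l _ => ?_
    rw [integral_smul_measure, integral_map measurable_prodMk_right.aemeasurable
      hf.meas.aestronglyMeasurable, ENNReal.toReal_ofReal (normWeight_nonneg hw l), smul_eq_mul]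
  · intro l _
    refine Integrable.smul_measure ?_ ENNReal.ofReal_ne_top
    have : IsProbabilityMeasure ((F.trans t (ξ l)).map fun x => (x, l)) :=
      Measure.isProbabilityMeasure_map measurable_prodMk_right.aemeasurable
    exact hf.integrable _

/-- Backward sampling inverts selection and mutation. -/
theorem Regular.sum_normWeight_lintegral_backWeight (hF : F.Regular G) [NeZero N] (ξ : Fin N → X)
    {φ : X → ENNReal} (hφ : Measurable φ) (l : Fin N) :
    ∑ a, ENNReal.ofReal (normWeight (F.weight t ξ) a) *
        ∫⁻ x, ENNReal.ofReal (normWeight (F.backWeight t ξ x) l) * φ x ∂F.trans t (ξ a)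
      = ENNReal.ofReal (normWeight (F.weight t ξ) l) * ∫⁻ x, φ x ∂F.trans t (ξ l) := by
  have hd : ∀ a, Measurable fun x => ENNReal.ofReal (F.dens t (ξ a) x) := fun a =>
    (F.measurable_dens t).of_uncurry_left.ennreal_ofReal
  have hb : Measurable fun x => ENNReal.ofReal (normWeight (F.backWeight t ξ x) l) := by
    refine Measurable.ennreal_ofReal (Measurable.div ?_ (Finset.measurable_sum _ fun a _ => ?_)) <;>
    exact (F.measurable_dens t).of_uncurry_left.const_mul _
  simp_rw [hF.hasDensities.2 t]
  have hwd : ∀ (a : Fin N) (f : X → ENNReal), Measurable f → ∀ c : ENNReal,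
      c * ∫⁻ x, f x ∂F.ν.withDensity (fun x => ENNReal.ofReal (F.dens t (ξ a) x))
        = ∫⁻ x, c * (ENNReal.ofReal (F.dens t (ξ a) x) * f x) ∂F.ν := fun a f hf c => by
    rw [lintegral_withDensity_eq_lintegral_mul _ (hd a) hf]
    exact (lintegral_const_mul _ ((hd a).mul hf)).symm
  have hbφ : Measurable fun x => ENNReal.ofReal (normWeight (F.backWeight t ξ x) l) * φ x :=
    hb.mul hφ
  have hm : ∀ a, Measurable fun x => ENNReal.ofReal (normWeight (F.weight t ξ) a) *
      (ENNReal.ofReal (F.dens t (ξ a) x) *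
        (ENNReal.ofReal (normWeight (F.backWeight t ξ x) l) * φ x)) :=
    fun a => ((hd a).mul hbφ).const_mul _
  rw [hwd l φ hφ, Finset.sum_congr rfl fun a _ => hwd a _ hbφ _,
    ← lintegral_finsetSum _ fun a _ => hm a]
  refine lintegral_congr fun x => ?_
  have hWn : ∀ a, 0 ≤ normWeight (F.weight t ξ) a :=
    normWeight_nonneg fun i => (hF.weight_pos t ξ i).le
  have hsum : 0 < ∑ a, F.weight t ξ a := sum_pos_of_pos (hF.weight_pos t ξ)
  have hbsum : 0 < ∑ a, F.backWeight t ξ x a := sum_pos_of_pos (hF.backWeight_pos t ξ x)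
  -- Bayes' formula: the mixture density ∑_a W_a m(ξ_a, x) is the normaliser of the backward weights
  -- divided by the total weight, so that normaliser cancels.
  have key : ∑ a, normWeight (F.weight t ξ) a * (F.dens t (ξ a) x *
      normWeight (F.backWeight t ξ x) l) = normWeight (F.weight t ξ) l * F.dens t (ξ l) x := by
    simp only [normWeight]
    have h1 : ∀ a, F.weight t ξ a / (∑ j, F.weight t ξ j) * (F.dens t (ξ a) x *
        (F.backWeight t ξ x l / ∑ j, F.backWeight t ξ x j))
        = F.backWeight t ξ x a * (F.backWeight t ξ x l /
          ((∑ j, F.weight t ξ j) * ∑ j, F.backWeight t ξ x j)) := fun a => by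
      rw [show F.backWeight t ξ x a = F.weight t ξ a * F.dens t (ξ a) x from rfl]
      field_simp
    simp_rw [h1]
    rw [← Finset.sum_mul, show F.backWeight t ξ x l = F.weight t ξ l * F.dens t (ξ l) x from rfl]
    field_simp
  have hbn : 0 ≤ normWeight (F.backWeight t ξ x) l :=
    normWeight_nonneg (fun i => (hF.backWeight_pos t ξ x i).le) l
  calc _ = (∑ a, ENNReal.ofReal (normWeight (F.weight t ξ) a * (F.dens t (ξ a) x *
      normWeight (F.backWeight t ξ x) l))) * φ x := by
        rw [Finset.sum_mul]
        refine Finset.sum_congr rfl fun a _ => ?_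
        rw [ENNReal.ofReal_mul (hWn a), ENNReal.ofReal_mul (F.dens_nonneg t _ _)]
        ring
    _ = _ := by
        rw [← ENNReal.ofReal_sum_of_nonneg fun a _ => mul_nonneg (hWn a)
          (mul_nonneg (F.dens_nonneg t _ _) hbn), key, ENNReal.ofReal_mul (hWn l)]
        ring

/-- Given the particles at time `t`, the pairs formed by a particle at time `t + 1` and its `i`-th
backward index are i.i.d. -/
theorem Regular.map_stepKernel (hF : F.Regular G) [NeZero N] (ξ : Fin N → X) (i : Fin M) :
    (F.stepKernel N M t ξ).map (fun m k => (m.2.1 k, m.2.2 k i))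
      = Measure.pi fun _ : Fin N => F.pairLaw t ξ := by
  have := hF.isMarkovKernel_selectKernel (N := N) t
  have := F.isMarkovKernel_mutateKernel N t
  have := hF.isMarkovKernel_backKernel (N := N) M t
  have := hF.isProbabilityMeasure_pairLaw (N := N) t ξ
  have hmeas : Measurable fun (m : Move X N M) k => (m.2.1 k, m.2.2 k i) := by fun_prop
  refine (Measure.pi_eq fun s hs => ?_).symm
  rw [Measure.map_apply hmeas (MeasurableSet.univ_pi hs)]
  set S : Set (Move X N M) := (fun m k => (m.2.1 k, m.2.2 k i)) ⁻¹' Set.univ.pi s with hS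
  have hSm : MeasurableSet S := hmeas (MeasurableSet.univ_pi hs)
  -- The probability that (x, J) lies in `s k`, given that the k-th new particle is x. Backward
  -- indices, particles and ancestors are integrated out in this order, and each stage factorises
  -- over k.
  set B : Fin N → X → ENNReal := fun k x => ∑ l,
    ENNReal.ofReal (normWeight (F.backWeight t ξ x) l) * (s k).indicator 1 (x, l) with hB
  have hind : ∀ k l, Measurable fun x => (s k).indicator (1 : X × Fin N → ENNReal) (x, l) :=
    fun k l => (measurable_one.indicator (hs k)).comp measurable_prodMk_right
  have hbw : ∀ l, Measurable fun x => ENNReal.ofReal (normWeight (F.backWeight t ξ x) l) := by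
    intro l
    refine Measurable.ennreal_ofReal (Measurable.div ?_ (Finset.measurable_sum _ fun a _ => ?_)) <;>
    exact (F.measurable_dens t).of_uncurry_left.const_mul _
  have hBm : ∀ k, Measurable (B k) := fun k =>
    Finset.measurable_sum _ fun l _ => (hbw l).mul (hind k l)
  have hback : ∀ A ξ', F.backKernel N M t ((ξ, A), ξ') {J | (A, ξ', J) ∈ S} = ∏ k, B k (ξ' k) := by
    intro A ξ'
    have h1 : {J : Fin N → Fin M → Fin N | (A, ξ', J) ∈ S}
        = Set.univ.pi fun k => (fun r : Fin M → Fin N => r i) ⁻¹' {l | (ξ' k, l) ∈ s k} := by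
      ext J
      simp [hS, Set.mem_pi]
    rw [h1, backKernel, piKernel_apply, Measure.pi_pi]
    refine Finset.prod_congr rfl fun k _ => ?_
    rw [backRowKernel, piKernel_apply]
    have := isMarkovKernel_catKernel (F.measurable_backWeight (N := N) t k)
      fun p => hF.backWeight_pos t p.1.1 (p.2 k)
    rw [(measurePreserving_eval (fun _ : Fin M => catKernel (fun p : ((Fin N → X) × (Fin N → Fin N))
      × (Fin N → X) => F.backWeight t p.1.1 (p.2 k)) (F.measurable_backWeight t k)
        ((ξ, A), ξ')) i).measure_preimage (MeasurableSet.of_discrete).nullMeasurableSet,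
      ← lintegral_indicator_one MeasurableSet.of_discrete, lintegral_catKernel]
    rfl
  have hmut : ∀ A, (F.mutateKernel N t ⊗ₖ F.backKernel N M t) (ξ, A) (Prod.mk A ⁻¹' S)
      = ∏ k, ∫⁻ x, B k x ∂F.trans t (ξ (A k)) := by
    intro A
    rw [Kernel.compProd_apply (measurable_prodMk_left hSm)]
    have h2 : ∀ ξ', F.backKernel N M t ((ξ, A), ξ') (Prod.mk ξ' ⁻¹' (Prod.mk A ⁻¹' S))
        = ∏ k, B k (ξ' k) := fun ξ' => hback A ξ'
    simp_rw [h2]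
    rw [mutateKernel, piKernel_apply, lintegral_pi_prod _ hBm]
    rfl
  rw [stepKernel, Kernel.compProd_apply hSm]
  simp_rw [hmut]
  have := isMarkovKernel_catKernel (F.measurable_weight (N := N) t) (hF.weight_pos t)
  rw [selectKernel, piKernel_apply, lintegral_pi_prod (fun _ : Fin N =>
    catKernel (F.weight t) (F.measurable_weight t) ξ)
    (f := fun k a => ∫⁻ x, B k x ∂F.trans t (ξ a)) (fun k => Measurable.of_discrete)]
  refine Finset.prod_congr rfl fun k _ => ?_
  rw [lintegral_catKernel, pairLaw_apply t ξ (hs k)]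
  simp only [hB]
  have hsum : ∀ a, ∫⁻ x, ∑ l, ENNReal.ofReal (normWeight (F.backWeight t ξ x) l)
      * (s k).indicator 1 (x, l) ∂F.trans t (ξ a)
      = ∑ l, ∫⁻ x, ENNReal.ofReal (normWeight (F.backWeight t ξ x) l)
        * (s k).indicator 1 (x, l) ∂F.trans t (ξ a) :=
    fun a => lintegral_finsetSum _ fun l _ => (hbw l).mul (hind k l)
  simp_rw [hsum, Finset.mul_sum]
  -- For a fixed backward index the sum over ancestors is the one evaluated by Bayes' formula; the
  -- backward index then plays the role of the ancestor in `pairLaw`.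
  rw [Finset.sum_comm]
  refine Finset.sum_congr rfl fun l _ => ?_
  rw [hF.sum_normWeight_lintegral_backWeight t ξ (hind k l) l]
  congr 1
  rw [← lintegral_indicator_one (measurable_prodMk_right (hs k))]
  rfl

end Model

/-! ### Moments of functions of a few coordinates under an i.i.d. product -/

section PiIntegrals

variable {ι E : Type*} [Fintype ι] [MeasurableSpace E] (ρ : Measure E) [IsProbabilityMeasure ρ]

theorem iIndepFun_eval_pi : iIndepFun (fun i (y : ι → E) => y i) (Measure.pi fun _ : ι => ρ) :=
  iIndepFun_pi (X := fun (_ : ι) (x : E) => x) fun _ => aemeasurable_id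

theorem integral_pi_eval {f : E → ℝ} (hf : BddMeas f) (k : ι) :
    ∫ y, f (y k) ∂(Measure.pi fun _ : ι => ρ) = ∫ x, f x ∂ρ := by
  have h := integral_map (μ := Measure.pi fun _ : ι => ρ) (φ := Function.eval k) (f := f)
    (measurable_pi_apply k).aemeasurable hf.meas.aestronglyMeasurable
  rw [(measurePreserving_eval (fun _ : ι => ρ) k).map_eq] at h
  exact h.symm

theorem integral_pi_eval_mul_eval {f g : E → ℝ} (hf : BddMeas f) (hg : BddMeas g) {k l : ι}
    (hkl : k ≠ l) :
    ∫ y, f (y k) * g (y l) ∂(Measure.pi fun _ : ι => ρ) = (∫ x, f x ∂ρ) * ∫ x, g x ∂ρ := by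
  rw [← integral_pi_eval ρ hf k, ← integral_pi_eval ρ hg l]
  exact IndepFun.integral_fun_comp_mul_comp ((iIndepFun_eval_pi ρ).indepFun hkl)
    (measurable_pi_apply k).aemeasurable (measurable_pi_apply l).aemeasurable
    hf.meas.aestronglyMeasurable hg.meas.aestronglyMeasurable

theorem integral_pi_eval_mul_eval_mul_eval {f g h : E → ℝ} (hf : BddMeas f) (hg : BddMeas g)
    (hh : BddMeas h) {k l m : ι} (hkl : k ≠ l) (hkm : k ≠ m) (hlm : l ≠ m) :
    ∫ y, f (y k) * g (y l) * h (y m) ∂(Measure.pi fun _ : ι => ρ)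
      = (∫ x, f x ∂ρ) * (∫ x, g x ∂ρ) * ∫ x, h x ∂ρ := by
  rw [← integral_pi_eval_mul_eval ρ hf hg hkl, ← integral_pi_eval ρ hh m]
  exact IndepFun.integral_fun_comp_mul_comp
    ((iIndepFun_eval_pi ρ).indepFun_prodMk (fun i => measurable_pi_apply i) k l m hkm hlm)
    (f := fun p : E × E => f p.1 * g p.2)
    ((measurable_pi_apply k).prodMk (measurable_pi_apply l)).aemeasurable
    (measurable_pi_apply m).aemeasurable
    ((hf.meas.comp measurable_fst).mul (hg.meas.comp measurable_snd)).aestronglyMeasurable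
    hh.meas.aestronglyMeasurable

/-- The cases k = l and k' = l' are allowed: they are needed for the diagonal terms of the
coalescence update. -/
theorem integral_pi_pair_mul_pair {f g : E × E → ℝ} (hf : BddMeas f) (hg : BddMeas g)
    {k l k' l' : ι} (h₁ : k ≠ k') (h₂ : k ≠ l') (h₃ : l ≠ k') (h₄ : l ≠ l') :
    ∫ y, f (y k, y l) * g (y k', y l') ∂(Measure.pi fun _ : ι => ρ)
      = (∫ y, f (y k, y l) ∂(Measure.pi fun _ : ι => ρ))
        * ∫ y, g (y k', y l') ∂(Measure.pi fun _ : ι => ρ) :=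
  IndepFun.integral_fun_comp_mul_comp
    ((iIndepFun_eval_pi ρ).indepFun_prodMk_prodMk (fun i => measurable_pi_apply i)
      k l k' l' h₁ h₂ h₃ h₄)
    ((measurable_pi_apply k).prodMk (measurable_pi_apply l)).aemeasurable
    ((measurable_pi_apply k').prodMk (measurable_pi_apply l')).aemeasurable
    hf.meas.aestronglyMeasurable hg.meas.aestronglyMeasurable

/-- Variance of a sum of i.i.d. variables. -/
theorem integral_sq_sum_eval_sub_le {f : E → ℝ} (hf : BddMeas f) {C : ℝ} (hC : 0 ≤ C)
    (hfC : ∀ x, |f x| ≤ C) :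
    ∫ y, (∑ k, f (y k) - Fintype.card ι * ∫ x, f x ∂ρ) ^ 2 ∂(Measure.pi fun _ : ι => ρ)
      ≤ 8 * C ^ 2 * Fintype.card ι := by
  classical
  have hfk : ∀ k : ι, BddMeas fun y : ι → E => f (y k) := fun k => hf.comp (measurable_pi_apply k)
  -- The single sum is treated as a diagonal array; the dominating array is the identity, with row
  -- sums 1.
  have h := integral_sq_sub_le_of_disjoint_uncorrelated (Measure.pi fun _ : ι => ρ)
    (X := fun k l y => if k = l then f (y k) else 0) (T := fun k l _ => if k = l then 1 else 0)
    (fun k l => (hfk k).ite_const _ (BddMeas.const 0)) (fun k l => BddMeas.const _)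
    (C := C) (fun k l y => by
      by_cases h : k = l
      · simpa [h] using hfC (y l)
      · simp [h]) hC
    (fun k l _ => by positivity) (fun k l _ => by simp [eq_comm])
    (fun k l k' l' h₁ h₂ h₃ h₄ => by
      by_cases h : k = l <;> by_cases h' : k' = l' <;> simp only [h, h', if_true, if_false,
        zero_mul, mul_zero, integral_zero]
      subst h h'
      rw [integral_pi_eval_mul_eval ρ hf hf h₁, integral_pi_eval ρ hf, integral_pi_eval ρ hf])
  have e : ∀ y : ι → E, ∑ k, ∑ l, (if k = l then f (y k) else 0) = ∑ k, f (y k) := fun y => by simp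
  have e2 : ∫ y, ∑ k, f (y k) ∂(Measure.pi fun _ : ι => ρ) = Fintype.card ι * ∫ x, f x ∂ρ := by
    rw [integral_sum_of_bddMeas _ hfk]
    simp [integral_pi_eval ρ hf]
  simp only [e, e2] at h
  simpa using h

end PiIntegrals

/-- Jensen's inequality over the backward indices of a particle: second moments of averages over i
reduce to those for one index, whatever the dependence between indices. -/
theorem sq_mean_le {M : ℕ} (x : Fin M → ℝ) :
    ((M : ℝ)⁻¹ * ∑ i, x i) ^ 2 ≤ (M : ℝ)⁻¹ * ∑ i, x i ^ 2 := by
  rcases Nat.eq_zero_or_pos M with rfl | hM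
  · simp
  have hM' : (0 : ℝ) < M := Nat.cast_pos.2 hM
  have h := sq_sum_le_card_mul_sum_sq (s := Finset.univ) (f := x)
  rw [Finset.card_univ, Fintype.card_fin] at h
  rw [mul_pow, inv_pow, inv_mul_le_iff₀ (by positivity)]
  calc (∑ i, x i) ^ 2 ≤ M * ∑ i, x i ^ 2 := h
    _ = _ := by field_simp

/-! ### One step of the coalescence statistics, for a single backward index -/

section CoalUpdate

variable {N : ℕ}

/-- The recursion of the coalescence statistics when a single backward index `η k` is used for
every particle `k`. -/
def coalUpdate (W : Fin N → ℝ) (T : Fin N → Fin N → ℝ) (c : Fin 2) (η : Fin N → Fin N)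
    (k l : Fin N) : ℝ :=
  if c = 0 then (if k ≠ l then T (η k) (η l) else 0)
  else (if k = l then ∑ j, W j * T (η k) j else 0)

variable {W : Fin N → ℝ} {T : Fin N → Fin N → ℝ} (c : Fin 2) (η : Fin N → Fin N)

theorem coalUpdate_nonneg (hW : ∀ j, 0 ≤ W j) (hT : ∀ k l, 0 ≤ T k l) (k l : Fin N) :
    0 ≤ coalUpdate W T c η k l := by
  unfold coalUpdate
  split_ifs
  · exact hT _ _
  · exact le_rfl
  · exact Finset.sum_nonneg fun j _ => mul_nonneg (hW j) (hT _ _)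
  · exact le_rfl

theorem coalUpdate_le_one (hW : ∀ j, 0 ≤ W j) (hW1 : ∑ j, W j = 1) (hT : ∀ k l, T k l ≤ 1)
    (k l : Fin N) : coalUpdate W T c η k l ≤ 1 := by
  unfold coalUpdate
  split_ifs
  · exact hT _ _
  · exact zero_le_one
  · exact (Finset.sum_le_sum fun j _ => mul_le_of_le_one_right (hW j) (hT _ _)).trans hW1.le
  · exact zero_le_one

theorem coalUpdate_symm (hT : ∀ k l, T k l = T l k) (k l : Fin N) :
    coalUpdate W T c η k l = coalUpdate W T c η l k := by
  unfold coalUpdate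
  by_cases h : k = l
  · subst h; rfl
  · simp [h, Ne.symm h, hT (η k)]

/-- When the bit is 1 the updated array is diagonal, so each row sum is a single entry in [0, 1]. -/
theorem sum_sq_coalUpdate_le (hW : ∀ j, 0 ≤ W j) (hW1 : ∑ j, W j = 1) (hT0 : ∀ k l, 0 ≤ T k l)
    (hT : ∀ k l, T k l ≤ 1) (hc : c ≠ 0) :
    ∑ k, (∑ l, coalUpdate W T c η k l) ^ 2 ≤ N := by
  calc _ ≤ ∑ _k : Fin N, (1 : ℝ) := Finset.sum_le_sum fun k _ => by
        have h : ∑ l, coalUpdate W T c η k l = coalUpdate W T c η k k := by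
          rw [Finset.sum_eq_single k] <;> simp +contextual [coalUpdate, hc, eq_comm]
        rw [h]
        exact pow_le_one₀ (coalUpdate_nonneg c η hW hT0 k k)
          (coalUpdate_le_one c η hW hW1 hT k k)
    _ = N := by simp

end CoalUpdate

/-! ### Conditional moments of the update with a single backward index -/

namespace Model

variable {X : Type*} [MeasurableSpace X] {F : Model X} {G : ℝ} {N : ℕ} {t : ℕ}

/-- The action of `M_{t+1}` on functions. -/
def transInt (F : Model X) (t : ℕ) (φ : X → ℝ) (x : X) : ℝ := ∫ y, φ y ∂F.trans t x

/-- The action of `Q_{t+1}` on functions. -/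
def QInt (F : Model X) (t : ℕ) (φ : X → ℝ) (x : X) : ℝ := F.pot t x * F.transInt t φ x

theorem bddMeas_transInt {φ : X → ℝ} (hφ : BddMeas φ) : BddMeas (F.transInt t φ) :=
  (hφ.comp measurable_snd).integral_kernel (F.trans t)

namespace Regular

theorem bddMeas_pot (hF : F.Regular G) : BddMeas (F.pot t) :=
  ⟨F.measurable_pot t, G, fun x => by rw [abs_of_pos (hF.pot_pos t x)]; exact hF.pot_le t x⟩

theorem bddMeas_QInt (hF : F.Regular G) {φ : X → ℝ} (hφ : BddMeas φ) : BddMeas (F.QInt t φ) :=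
  hF.bddMeas_pot.mul (bddMeas_transInt hφ)

end Regular

theorem bddMeas_pairFun {φ : X → ℝ} (hφ : BddMeas φ) (u : Fin N → ℝ) :
    BddMeas fun y : X × Fin N => u y.2 * φ y.1 :=
  ((BddMeas.of_finite u).comp measurable_snd).mul (hφ.comp measurable_fst)

theorem bddMeas_coalUpdate (W : Fin N → ℝ) (T : Fin N → Fin N → ℝ) (c : Fin 2) (k l : Fin N) :
    BddMeas fun y : Fin N → X × Fin N => coalUpdate W T c (fun k => (y k).2) k l :=
  (BddMeas.of_finite fun η : Fin N → Fin N => coalUpdate W T c η k l).comp (by fun_prop)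

theorem bddMeas_coalUpdate_mul (W : Fin N → ℝ) (T : Fin N → Fin N → ℝ) (c : Fin 2) {φ ψ : X → ℝ}
    (hφ : BddMeas φ) (hψ : BddMeas ψ) (k l : Fin N) :
    BddMeas fun y : Fin N → X × Fin N =>
      coalUpdate W T c (fun k => (y k).2) k l * (φ (y k).1 * ψ (y l).1) :=
  (bddMeas_coalUpdate W T c k l).mul
    ((hφ.comp (by fun_prop)).mul (hψ.comp (by fun_prop)))

/-- The (k, l) summand is a function of the coordinates k and l only, so disjoint pairs are
independent; the update itself, scaled by C, is the dominating array. -/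
theorem integral_sq_coalUpdate_sub_le (ρ : Measure (X × Fin N)) [IsProbabilityMeasure ρ]
    {W : Fin N → ℝ} {T : Fin N → Fin N → ℝ} {φ ψ : X → ℝ} (hφ : BddMeas φ) (hψ : BddMeas ψ)
    {C : ℝ} (hC : 0 ≤ C) (hφψ : ∀ x y, |φ x * ψ y| ≤ C) (hW : ∀ j, 0 ≤ W j)
    (hT0 : ∀ a b, 0 ≤ T a b) (hsymm : ∀ a b, T a b = T b a) (c : Fin 2) :
    ∫ y, (∑ k, ∑ l, coalUpdate W T c (fun k => (y k).2) k l * (φ (y k).1 * ψ (y l).1)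
      - ∫ y', ∑ k, ∑ l, coalUpdate W T c (fun k => (y' k).2) k l
        * (φ (y' k).1 * ψ (y' l).1) ∂(Measure.pi fun _ : Fin N => ρ)) ^ 2
        ∂(Measure.pi fun _ : Fin N => ρ)
      ≤ 8 * C ^ 2 * ∫ y, ∑ k, (∑ l, coalUpdate W T c
        (fun k => (y k).2) k l) ^ 2 ∂(Measure.pi fun _ : Fin N => ρ) := by
  have hHb : ∀ k l : Fin N, BddMeas fun p : (X × Fin N) × (X × Fin N) =>
      (if c = 0 then (if k ≠ l then T p.1.2 p.2.2 else 0)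
      else (if k = l then ∑ j, W j * T p.1.2 j else 0)) * (φ p.1.1 * ψ p.2.1) := fun k l => by
    refine BddMeas.mul ?_ ((hφ.comp (by fun_prop)).mul (hψ.comp (by fun_prop)))
    exact (BddMeas.of_finite fun q : Fin N × Fin N => if c = 0 then (if k ≠ l then T q.1 q.2 else 0)
      else (if k = l then ∑ j, W j * T q.1 j else 0)).comp
        (u := fun p : (X × Fin N) × (X × Fin N) => (p.1.2, p.2.2)) (by fun_prop)
  have hle : ∀ k l (y : Fin N → X × Fin N),
      |coalUpdate W T c (fun k => (y k).2) k l * (φ (y k).1 * ψ (y l).1)|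
        ≤ C * coalUpdate W T c (fun k => (y k).2) k l := fun k l y => by
    rw [abs_mul, abs_of_nonneg (coalUpdate_nonneg c _ hW hT0 k l), mul_comm]
    exact mul_le_mul_of_nonneg_right (hφψ _ _) (coalUpdate_nonneg c _ hW hT0 k l)
  exact integral_sq_sub_le_of_disjoint_uncorrelated (Measure.pi fun _ : Fin N => ρ)
    (X := fun k l y => coalUpdate W T c (fun k => (y k).2) k l * (φ (y k).1 * ψ (y l).1))
    (T := fun k l y => coalUpdate W T c (fun k => (y k).2) k l)
    (bddMeas_coalUpdate_mul W T c hφ hψ) (bddMeas_coalUpdate W T c) hle hC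
    (fun k l y => coalUpdate_nonneg c _ hW hT0 k l) (fun k l y => coalUpdate_symm c _ hsymm k l)
    (fun k l k' l' => integral_pi_pair_mul_pair ρ (hHb k l) (hHb k' l'))

section PairLaw

variable (hF : F.Regular G) (ξ : Fin N → X)
include hF

theorem Regular.integral_pairLaw_mul {φ : X → ℝ} (hφ : BddMeas φ) (u : Fin N → ℝ) :
    ∫ y, u y.2 * φ y.1 ∂F.pairLaw t ξ
      = ∑ a, normWeight (F.weight t ξ) a * (u a * F.transInt t φ (ξ a)) := by
  rw [integral_pairLaw t ξ (bddMeas_pairFun hφ u) fun i => (hF.weight_pos t ξ i).le]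
  simp only [integral_const_mul]
  rfl

theorem Regular.integral_pairLaw_ite {φ : X → ℝ} (hφ : BddMeas φ) (a : Fin N) :
    ∫ y, (if y.2 = a then 1 else 0) * φ y.1 ∂F.pairLaw t ξ
      = normWeight (F.weight t ξ) a * F.transInt t φ (ξ a) := by
  rw [hF.integral_pairLaw_mul ξ hφ fun b => if b = a then 1 else 0]
  simp

variable {T : Fin N → Fin N → ℝ} [NeZero N]

/-- Splitting `T` according to the values of the two indices turns the integrand into a combination
of products of one-coordinate functions, to which independence applies. -/
theorem Regular.integral_pair {φ ψ : X → ℝ} (hφ : BddMeas φ) (hψ : BddMeas ψ) {k l : Fin N}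
    (hkl : k ≠ l) :
    ∫ y, T (y k).2 (y l).2 * (φ (y k).1 * ψ (y l).1) ∂(Measure.pi fun _ : Fin N => F.pairLaw t ξ)
      = ∑ a, ∑ b, T a b * ((normWeight (F.weight t ξ) a * F.transInt t φ (ξ a))
        * (normWeight (F.weight t ξ) b * F.transInt t ψ (ξ b))) := by
  have := hF.isProbabilityMeasure_pairLaw (N := N) t ξ
  have hφa : ∀ a, BddMeas fun y : X × Fin N => (if y.2 = a then 1 else 0) * φ y.1 := fun a =>
    bddMeas_pairFun hφ fun b => if b = a then 1 else 0
  have hψb : ∀ a, BddMeas fun y : X × Fin N => (if y.2 = a then 1 else 0) * ψ y.1 := fun a =>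
    bddMeas_pairFun hψ fun b => if b = a then 1 else 0
  have h : ∀ y : Fin N → X × Fin N, T (y k).2 (y l).2 * (φ (y k).1 * ψ (y l).1)
      = ∑ a, ∑ b, T a b * (((if (y k).2 = a then 1 else 0) * φ (y k).1)
        * ((if (y l).2 = b then 1 else 0) * ψ (y l).1)) := fun y => by simp
  have hb : ∀ a b, BddMeas fun y : Fin N → X × Fin N =>
      T a b * (((if (y k).2 = a then 1 else 0) * φ (y k).1)
        * ((if (y l).2 = b then 1 else 0) * ψ (y l).1)) := fun a b =>
    (((hφa a).comp (measurable_pi_apply k)).mul ((hψb b).comp (measurable_pi_apply l))).const_mul _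
  simp_rw [h]
  rw [integral_sum_of_bddMeas _ fun a => BddMeas.sum fun b => hb a b]
  refine Finset.sum_congr rfl fun a _ => ?_
  rw [integral_sum_of_bddMeas _ fun b => hb a b]
  refine Finset.sum_congr rfl fun b _ => ?_
  rw [integral_const_mul, integral_pi_eval_mul_eval _ (hφa a) (hψb b) hkl,
    hF.integral_pairLaw_ite ξ hφ, hF.integral_pairLaw_ite ξ hψ]

/-- The cross terms of a squared row sum: given the index of k, those of l and m are independent
draws from the weights, which produces the square. -/
theorem Regular.integral_triple {k l m : Fin N} (hkl : k ≠ l) (hkm : k ≠ m) (hlm : l ≠ m) :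
    ∫ y, T (y k).2 (y l).2 * T (y k).2 (y m).2 ∂(Measure.pi fun _ : Fin N => F.pairLaw t ξ)
      = ∑ a, normWeight (F.weight t ξ) a
        * (∑ b, normWeight (F.weight t ξ) b * T a b) ^ 2 := by
  have := hF.isProbabilityMeasure_pairLaw (N := N) t ξ
  have hi : ∀ a : Fin N, BddMeas fun y : X × Fin N => if y.2 = a then (1 : ℝ) else 0 := fun a =>
    (BddMeas.of_finite fun b => if b = a then (1 : ℝ) else 0).comp measurable_snd
  have hint : ∀ a, ∫ y, (if y.2 = a then (1 : ℝ) else 0) ∂F.pairLaw t ξ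
      = normWeight (F.weight t ξ) a := fun a => by
    have := hF.integral_pairLaw_ite (t := t) ξ (BddMeas.const 1) a
    simpa [transInt] using this
  have h : ∀ y : Fin N → X × Fin N, T (y k).2 (y l).2 * T (y k).2 (y m).2
      = ∑ a, ∑ b, ∑ c, T a b * T a c * ((if (y k).2 = a then 1 else 0)
        * (if (y l).2 = b then 1 else 0) * (if (y m).2 = c then 1 else 0)) := fun y => by simp
  have hb : ∀ a b c, BddMeas fun y : Fin N → X × Fin N =>
      T a b * T a c * ((if (y k).2 = a then 1 else 0)
        * (if (y l).2 = b then 1 else 0) * (if (y m).2 = c then 1 else 0)) := fun a b c =>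
    ((((hi a).comp (measurable_pi_apply k)).mul ((hi b).comp (measurable_pi_apply l))).mul
      ((hi c).comp (measurable_pi_apply m))).const_mul _
  simp_rw [h]
  rw [integral_sum_of_bddMeas _ fun a => BddMeas.sum fun b => BddMeas.sum fun c => hb a b c]
  refine Finset.sum_congr rfl fun a _ => ?_
  rw [integral_sum_of_bddMeas _ fun b => BddMeas.sum fun c => hb a b c, pow_two,
    Finset.sum_mul_sum, Finset.mul_sum]
  refine Finset.sum_congr rfl fun b _ => ?_
  rw [integral_sum_of_bddMeas _ fun c => hb a b c, Finset.mul_sum]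
  refine Finset.sum_congr rfl fun c _ => ?_
  rw [integral_const_mul, integral_pi_eval_mul_eval_mul_eval _ (hi a) (hi b) (hi c) hkl hkm hlm,
    hint, hint, hint]
  ring

theorem Regular.integral_coalUpdate_zero {φ ψ : X → ℝ} (hφ : BddMeas φ) (hψ : BddMeas ψ) :
    ∫ y, ∑ k, ∑ l, coalUpdate (normWeight (F.weight t ξ)) T 0 (fun k => (y k).2) k l
        * (φ (y k).1 * ψ (y l).1) ∂(Measure.pi fun _ : Fin N => F.pairLaw t ξ)
      = N * (N - 1) * ∑ a, ∑ b, T a b * ((normWeight (F.weight t ξ) a * F.transInt t φ (ξ a))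
        * (normWeight (F.weight t ξ) b * F.transInt t ψ (ξ b))) := by
  have := hF.isProbabilityMeasure_pairLaw (N := N) t ξ
  set R := ∑ a, ∑ b, T a b * ((normWeight (F.weight t ξ) a * F.transInt t φ (ξ a))
        * (normWeight (F.weight t ξ) b * F.transInt t ψ (ξ b)))
  have hb := bddMeas_coalUpdate_mul (normWeight (F.weight t ξ)) T 0 hφ hψ
  rw [integral_sum_of_bddMeas _ fun k => BddMeas.sum fun l => hb k l]
  -- Off the diagonal all integrals equal `R`. Subtracting the diagonal from the full square gives
  -- the factor N² - N.
  have h : ∀ k l, ∫ y, coalUpdate (normWeight (F.weight t ξ)) T 0 (fun k => (y k).2) k l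
        * (φ (y k).1 * ψ (y l).1) ∂(Measure.pi fun _ : Fin N => F.pairLaw t ξ)
      = R - if k = l then R else 0 := fun k l => by
    by_cases hkl : k = l
    · simp [hkl, coalUpdate]
    · simp only [coalUpdate, hkl, if_true, if_false, ne_eq, not_false_eq_true, sub_zero]
      exact hF.integral_pair ξ hφ hψ hkl
  simp_rw [integral_sum_of_bddMeas _ fun l => hb _ l, h]
  simp
  ring

/-- Only k = l survives, so both functions are evaluated at one particle. The second slot of `T` is
averaged over the weights and carries no function. -/
theorem Regular.integral_coalUpdate_one {φ ψ : X → ℝ} (hφ : BddMeas φ) (hψ : BddMeas ψ) {c : Fin 2}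
    (hc : c ≠ 0) :
    ∫ y, ∑ k, ∑ l, coalUpdate (normWeight (F.weight t ξ)) T c (fun k => (y k).2) k l
        * (φ (y k).1 * ψ (y l).1) ∂(Measure.pi fun _ : Fin N => F.pairLaw t ξ)
      = N * ∑ a, ∑ b, T a b * ((normWeight (F.weight t ξ) a *
          F.transInt t (fun x => φ x * ψ x) (ξ a)) * normWeight (F.weight t ξ) b) := by
  have := hF.isProbabilityMeasure_pairLaw (N := N) t ξ
  set u : Fin N → ℝ := fun a => ∑ j, normWeight (F.weight t ξ) j * T a j with hu
  have h : ∀ (y : Fin N → X × Fin N) k, ∑ l, coalUpdate (normWeight (F.weight t ξ)) T c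
      (fun k => (y k).2) k l * (φ (y k).1 * ψ (y l).1) = u (y k).2 * (φ (y k).1 * ψ (y k).1) :=
    fun y k => by
      rw [Finset.sum_eq_single k]
      · simp [coalUpdate, hc, hu]
      · intro l _ hl
        simp [coalUpdate, hc, Ne.symm hl]
      · simp
  simp_rw [h]
  have hb : BddMeas fun y : X × Fin N => u y.2 * (φ y.1 * ψ y.1) :=
    bddMeas_pairFun (hφ.mul hψ) u
  rw [integral_sum_of_bddMeas _ fun k => hb.comp (measurable_pi_apply k)]
  simp_rw [integral_pi_eval (F.pairLaw t ξ) hb, hF.integral_pairLaw_mul ξ (hφ.mul hψ) u]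
  simp only [Finset.sum_const, Finset.card_univ, Fintype.card_fin, nsmul_eq_mul, hu]
  congr 1
  refine Finset.sum_congr rfl fun a _ => ?_
  rw [Finset.sum_mul, Finset.mul_sum]
  exact Finset.sum_congr rfl fun b _ => by ring

/-- Expand each squared row sum over l and m. The N² terms with l = m use T² ≤ T; the remaining, at
most N³, terms are triple moments or vanish. -/
theorem Regular.integral_sq_coalUpdate_zero_le (hT0 : ∀ a b, 0 ≤ T a b) (hT1 : ∀ a b, T a b ≤ 1) :
    ∫ y, ∑ k, (∑ l, coalUpdate (normWeight (F.weight t ξ)) T 0 (fun k => (y k).2) k l) ^ 2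
        ∂(Measure.pi fun _ : Fin N => F.pairLaw t ξ)
      ≤ N ^ 2 * (∑ a, ∑ b, T a b * (normWeight (F.weight t ξ) a * normWeight (F.weight t ξ) b))
        + N ^ 3 * ∑ a, normWeight (F.weight t ξ) a
          * (∑ b, normWeight (F.weight t ξ) b * T a b) ^ 2 := by
  have := hF.isProbabilityMeasure_pairLaw (N := N) t ξ
  have hW : ∀ j, 0 ≤ normWeight (F.weight t ξ) j :=
    normWeight_nonneg fun i => (hF.weight_pos t ξ i).le
  set W := normWeight (F.weight t ξ) with hWdef
  set U := ∑ a, ∑ b, T a b * (W a * W b) with hU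
  set V := ∑ a, W a * (∑ b, W b * T a b) ^ 2 with hV
  have hU0 : 0 ≤ U := Finset.sum_nonneg fun a _ => Finset.sum_nonneg fun b _ =>
    mul_nonneg (hT0 a b) (mul_nonneg (hW a) (hW b))
  have hV0 : 0 ≤ V := Finset.sum_nonneg fun a _ => mul_nonneg (hW a) (sq_nonneg _)
  have hb := bddMeas_coalUpdate (X := X) W T 0
  have hterm : ∀ k l m, ∫ y, coalUpdate W T 0 (fun k => (y k).2) k l
      * coalUpdate W T 0 (fun k => (y k).2) k m ∂(Measure.pi fun _ : Fin N => F.pairLaw t ξ)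
      ≤ (if l = m then U else 0) + V := by
    intro k l m
    by_cases hkl : k = l
    · have : ∀ y : Fin N → X × Fin N, coalUpdate W T 0 (fun k => (y k).2) k l
          * coalUpdate W T 0 (fun k => (y k).2) k m = 0 := fun y => by simp [coalUpdate, hkl]
      simp only [this, integral_zero]
      positivity
    by_cases hkm : k = m
    · have : ∀ y : Fin N → X × Fin N, coalUpdate W T 0 (fun k => (y k).2) k l
          * coalUpdate W T 0 (fun k => (y k).2) k m = 0 := fun y => by simp [coalUpdate, hkm]
      simp only [this, integral_zero]
      positivity
    by_cases hlm : l = m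
    · subst hlm
      have h1 : ∫ y, coalUpdate W T 0 (fun k => (y k).2) k l
          ∂(Measure.pi fun _ : Fin N => F.pairLaw t ξ) = U := by
        have := hF.integral_pair (t := t) (T := T) ξ (BddMeas.const 1) (BddMeas.const 1) hkl
        simpa [coalUpdate, hkl, transInt] using this
      rw [if_pos rfl, ← h1]
      refine le_trans (integral_le_of_bddMeas ((hb k l).mul (hb k l)) (hb k l) _ fun y => ?_)
        (le_add_of_nonneg_right hV0)
      have h2 := coalUpdate_nonneg 0 (fun k => (y k).2) hW hT0 k l
      have h3 : coalUpdate W T 0 (fun k => (y k).2) k l ≤ 1 := by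
        simpa [coalUpdate, hkl] using hT1 _ _
      exact mul_le_of_le_one_right h2 h3
    · simp only [coalUpdate, hkl, hkm, hlm, if_true, if_false, ne_eq, not_false_eq_true, zero_add]
      exact (hF.integral_triple ξ hkl hkm hlm).le
  have hexp : ∀ y : Fin N → X × Fin N,
      ∑ k, (∑ l, coalUpdate W T 0 (fun k => (y k).2) k l) ^ 2
      = ∑ k, ∑ l, ∑ m, coalUpdate W T 0 (fun k => (y k).2) k l
        * coalUpdate W T 0 (fun k => (y k).2) k m := fun y => by
    simp_rw [pow_two, Finset.sum_mul_sum]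
  simp_rw [hexp]
  rw [integral_sum_of_bddMeas _ fun k => BddMeas.sum fun l => BddMeas.sum fun m =>
    (hb k l).mul (hb k m)]
  simp_rw [integral_sum_of_bddMeas _ fun l => BddMeas.sum fun m => (hb _ l).mul (hb _ m),
    integral_sum_of_bddMeas _ fun m => (hb _ _).mul (hb _ m)]
  calc _ ≤ ∑ k : Fin N, ∑ l : Fin N, ∑ m : Fin N, ((if l = m then U else 0) + V) :=
        Finset.sum_le_sum fun k _ => Finset.sum_le_sum fun l _ => Finset.sum_le_sum fun m _ =>
          hterm k l m
    _ = _ := by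
        simp [Finset.sum_add_distrib]
        ring

end PairLaw

end Model

/-! ### Runs extended by one move, and their coalescence statistics -/

theorem sum_fin_succ_pi {t : ℕ} (f : (Fin (t + 2) → Fin 2) → ℝ) :
    ∑ b, f b = ∑ c : Fin 2, ∑ b : Fin (t + 1) → Fin 2, f (Fin.snoc (α := fun _ => Fin 2) b c) := by
  rw [← (Fin.snocEquiv fun _ : Fin (t + 2) => Fin 2).sum_comp, Fintype.sum_prod_type]
  rfl

/-- A run extended by one move. -/
def Run.extend {X : Type*} {N M t : ℕ} (z : Run X N M t) (m : Move X N M) : Run X N M (t + 1) :=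
  (z, m)

@[simp]
theorem Run.particles_extend {X : Type*} {N M t : ℕ} (z : Run X N M t) (m : Move X N M)
    (k : Fin N) : (z.extend m).particles k = m.2.1 k := rfl

theorem Run.exists_extend {X : Type*} {N M t : ℕ} (z : Run X N M (t + 1)) :
    ∃ z' m, z = Run.extend (t := t) z' m :=
  ⟨z.1, z.2, rfl⟩

/-- The new particles of a move, paired with their `i`-th backward indices. -/
def Move.pairs {X : Type*} {N M : ℕ} (m : Move X N M) (i : Fin M) (k : Fin N) : X × Fin N :=
  (m.2.1 k, m.2.2 k i)

namespace Model

variable {X : Type*} [MeasurableSpace X] {F : Model X} {G : ℝ} {N M t : ℕ}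

theorem measurable_pairs (i : Fin M) : Measurable fun m : Move X N M => m.pairs i := by
  unfold Move.pairs
  fun_prop

/-- The common value of `weightProd` for all one-step extensions of a run. -/
def nextWeightProd (F : Model X) (z : Run X N M t) : ℝ :=
  F.weightProd z * ((N : ℝ)⁻¹ * ∑ i, F.weight t z.particles i)

@[simp]
theorem weightProd_extend (z : Run X N M t) (m : Move X N M) :
    F.weightProd (z.extend m) = F.nextWeightProd z := rfl

/-- The recursion is an average over i of updates that each see one backward index per particle.
This is what allows the indices to be treated one at a time. -/
theorem coalStat_extend (z : Run X N M t) (m : Move X N M) (b : Fin (t + 2) → Fin 2)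
    (k l : Fin N) :
    F.coalStat (z.extend m) b k l = (M : ℝ)⁻¹ * ∑ i, coalUpdate (normWeight
      (F.weight t z.particles)) (F.coalStat z fun s => b s.castSucc) (b (Fin.last (t + 1)))
        (fun k => (m.pairs i k).2) k l := by
  obtain ⟨A, ξ, J⟩ := m
  by_cases hb : b (Fin.last (t + 1)) = 0 <;> by_cases hkl : k = l <;>
    simp [Run.extend, coalStat, coalUpdate, Move.pairs, hb, hkl]

theorem coalStat_zero (z : Run X N M 0) (b : Fin 1 → Fin 2) (k l : Fin N) :
    F.coalStat z b k l
      = if b 0 = 0 then (if k ≠ l then 1 else 0) else (if k = l then 1 else 0) := by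
  simp [coalStat]

theorem weightProd_zero (z : Run X N M 0) : F.weightProd z = 1 := rfl

theorem coalStat_symm (z : Run X N M t) (b : Fin (t + 1) → Fin 2) (k l : Fin N) :
    F.coalStat z b k l = F.coalStat z b l k := by
  induction t generalizing k l with
  | zero => simp [coalStat_zero, eq_comm]
  | succ t ih =>
    obtain ⟨z, m, rfl⟩ := z.exists_extend
    rw [coalStat_extend, coalStat_extend]
    congr 1
    exact Finset.sum_congr rfl fun i _ => coalUpdate_symm _ _ (ih z _) k l

theorem coalStat_nonneg (hg : ∀ t x, 0 < F.pot t x) (z : Run X N M t) (b : Fin (t + 1) → Fin 2)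
    (k l : Fin N) : 0 ≤ F.coalStat z b k l := by
  induction t generalizing k l with
  | zero => rw [coalStat_zero]; positivity
  | succ t ih =>
    obtain ⟨z, m, rfl⟩ := z.exists_extend
    rw [coalStat_extend]
    exact mul_nonneg (by positivity) (Finset.sum_nonneg fun i _ => coalUpdate_nonneg _ _
      (normWeight_nonneg fun i => (hg _ _).le) (ih z _) k l)

/-- The last bit must be 1 on the diagonal and 0 off it. In both cases the sum over the other bits
is one by induction, with the normalised weights summing to one in the diagonal case. -/
theorem sum_coalStat (hg : ∀ t x, 0 < F.pot t x) (hM : M ≠ 0) (z : Run X N M t) (k l : Fin N) :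
    ∑ b, F.coalStat z b k l = 1 := by
  have : NeZero N := ⟨fun h => by subst h; exact k.elim0⟩
  induction t generalizing k l with
  | zero =>
    rw [← (Equiv.funUnique (Fin 1) (Fin 2)).symm.sum_comp]
    by_cases h : k = l <;> simp [coalStat_zero, h, Fin.sum_univ_two]
  | succ t ih =>
    obtain ⟨z, m, rfl⟩ := z.exists_extend
    have hM' : (M : ℝ) ≠ 0 := Nat.cast_ne_zero.2 hM
    have hW := sum_normWeight (N := N) (w := F.weight t z.particles) fun i => hg t _
    rw [sum_fin_succ_pi]
    simp only [coalStat_extend, Fin.snoc_castSucc, Fin.snoc_last, ← Finset.mul_sum]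
    have h : ∀ i : Fin M, ∑ c : Fin 2, ∑ b : Fin (t + 1) → Fin 2,
        coalUpdate (normWeight (F.weight t z.particles)) (F.coalStat z fun s => b s) c
          (fun k => (m.pairs i k).2) k l = 1 := fun i => by
      rw [Fin.sum_univ_two]
      by_cases hkl : k = l
      · simp only [coalUpdate, hkl, if_true, if_false, ne_eq, not_true_eq_false, one_ne_zero,
          Finset.sum_const_zero, zero_add]
        rw [Finset.sum_comm]
        simp_rw [← Finset.mul_sum, ih z]
        simpa using hW
      · simp [coalUpdate, hkl, ih z]
    have h' : ∑ c : Fin 2, ∑ b : Fin (t + 1) → Fin 2, ∑ i : Fin M,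
        coalUpdate (normWeight (F.weight t z.particles)) (F.coalStat z fun s => b s) c
          (fun k => (m.pairs i k).2) k l = M := by
      simp_rw [Finset.sum_comm (s := (Finset.univ : Finset (Fin (t + 1) → Fin 2)))]
      rw [Finset.sum_comm]
      simp [h]
    rw [h', inv_mul_cancel₀ hM']

theorem coalStat_le_one (hg : ∀ t x, 0 < F.pot t x) (hM : M ≠ 0) (z : Run X N M t)
    (b : Fin (t + 1) → Fin 2) (k l : Fin N) : F.coalStat z b k l ≤ 1 := by
  rw [← sum_coalStat hg hM z k l]
  exact Finset.single_le_sum (f := fun b => F.coalStat z b k l)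
    (fun b _ => coalStat_nonneg hg z b k l) (Finset.mem_univ b)

theorem measurable_weight_particles (i : Fin N) :
    Measurable fun z : Run X N M t => F.weight t z.particles i :=
  (measurable_pi_apply i).comp ((F.measurable_weight t).comp (Run.measurable_particles t))

theorem measurable_weightProd : ∀ t, Measurable fun z : Run X N M t => F.weightProd z
  | 0 => measurable_const
  | t + 1 => by
    have h1 : Measurable fun p : Run X N M t × Move X N M => F.weightProd p.1 :=
      (measurable_weightProd t).comp measurable_fst
    have h2 : Measurable fun p : Run X N M t × Move X N M =>
        (N : ℝ)⁻¹ * ∑ i, F.weight t p.1.particles i :=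
      (Finset.measurable_sum _ fun i _ =>
        (measurable_weight_particles i).comp measurable_fst).const_mul _
    exact h1.mul h2

theorem measurable_coalStat (b : Fin (t + 1) → Fin 2) (k l : Fin N) :
    Measurable fun z : Run X N M t => F.coalStat z b k l := by
  induction t generalizing k l with
  | zero => simp only [coalStat_zero]; exact measurable_const
  | succ t ih =>
    change Measurable fun p : Run X N M t × Move X N M => F.coalStat (p.1.extend p.2) b k l
    simp only [coalStat_extend]
    refine (Finset.measurable_sum _ fun i _ => ?_).const_mul _
    have h2 : Measurable fun q : Run X N M t × (Fin N × Fin N) =>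
        F.coalStat q.1 (fun s => b s.castSucc) q.2.1 q.2.2 :=
      measurable_from_prod_countable_left fun p => ih _ p.1 p.2
    have hk : ∀ k, Measurable fun p : Run X N M t × Move X N M => (p.2.pairs i k).2 := fun k => by
      unfold Move.pairs
      fun_prop
    have hW : ∀ j, Measurable fun p : Run X N M t × Move X N M =>
        normWeight (F.weight t p.1.particles) j := fun j =>
      ((measurable_weight_particles j).comp measurable_fst).div
        (Finset.measurable_sum _ fun i _ => (measurable_weight_particles i).comp measurable_fst)
    unfold coalUpdate
    split_ifs
    · exact h2.comp (measurable_fst.prodMk ((hk k).prodMk (hk l)))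
    · exact measurable_const
    · exact Finset.measurable_sum _ fun j _ => (hW j).mul
        (h2.comp (measurable_fst.prodMk ((hk k).prodMk measurable_const)))
    · exact measurable_const

/-! ### Second-order estimators, row moments and the tower property -/

/-- The unscaled second order estimator
`γ_t^N(1)² N⁻² ∑_{i,j} 𝒯̃_t^b(i,j) φ(ξ_t^i) ψ(ξ_t^j)`. -/
def pairEst (F : Model X) (z : Run X N M t) (b : Fin (t + 1) → Fin 2) (φ ψ : X → ℝ) : ℝ :=
  F.weightProd z ^ 2 / (N : ℝ) ^ 2 *
    ∑ i, ∑ j, F.coalStat z b i j * (φ (z.particles i) * ψ (z.particles j))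

/-- The weighted second moment of the row sums of the coalescence statistics. -/
def rowMoment (F : Model X) (z : Run X N M t) (b : Fin (t + 1) → Fin 2) : ℝ :=
  F.weightProd z ^ 3 * ∑ k, (∑ l, F.coalStat z b k l) ^ 2

theorem pairEst_extend (z : Run X N M t) (m : Move X N M) (b : Fin (t + 2) → Fin 2) (φ ψ : X → ℝ) :
    F.pairEst (z.extend m) b φ ψ = (M : ℝ)⁻¹ * ∑ i, F.nextWeightProd z ^ 2 / (N : ℝ) ^ 2 *
      ∑ k, ∑ l, coalUpdate (normWeight (F.weight t z.particles))
        (F.coalStat z fun s => b s.castSucc) (b (Fin.last (t + 1))) (fun k => (m.pairs i k).2) k l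
          * (φ (m.pairs i k).1 * ψ (m.pairs i l).1) := by
  simp only [pairEst, weightProd_extend, coalStat_extend, Run.particles_extend]
  rw [← Finset.mul_sum, mul_left_comm]
  congr 1
  rw [Finset.sum_comm (s := (Finset.univ : Finset (Fin M))), Finset.mul_sum]
  refine Finset.sum_congr rfl fun k _ => ?_
  rw [Finset.sum_comm (s := (Finset.univ : Finset (Fin M))), Finset.mul_sum]
  refine Finset.sum_congr rfl fun l _ => ?_
  rw [mul_assoc, Finset.sum_mul]
  rfl

namespace Regular

variable (hF : F.Regular G)
include hF

theorem sum_weight_le [NeZero N] (z : Run X N M t) :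
    (N : ℝ)⁻¹ * ∑ i, F.weight t z.particles i ≤ G := by
  have hN : (0 : ℝ) < N := Nat.cast_pos.2 (NeZero.pos N)
  rw [inv_mul_le_iff₀ hN]
  calc _ ≤ ∑ _i : Fin N, G := Finset.sum_le_sum fun i _ => hF.pot_le t _
    _ = _ := by simp

theorem weightProd_nonneg (z : Run X N M t) : 0 ≤ F.weightProd z := by
  induction t with
  | zero => exact zero_le_one
  | succ t ih =>
    obtain ⟨z, m, rfl⟩ := z.exists_extend
    exact mul_nonneg (ih z) (mul_nonneg (by positivity)
      (Finset.sum_nonneg fun i _ => (hF.weight_pos t _ i).le))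

theorem weightProd_le [NeZero N] (z : Run X N M t) : F.weightProd z ≤ G ^ t := by
  induction t with
  | zero => exact (weightProd_zero z).le.trans (by simp)
  | succ t ih =>
    obtain ⟨z, m, rfl⟩ := z.exists_extend
    rw [pow_succ]
    exact mul_le_mul (ih z) (hF.sum_weight_le z) (mul_nonneg (by positivity)
      (Finset.sum_nonneg fun i _ => (hF.weight_pos t _ i).le)) (pow_nonneg
        (zero_le_one.trans hF.one_le) t)

theorem nextWeightProd_nonneg (z : Run X N M t) : 0 ≤ F.nextWeightProd z :=
  mul_nonneg (hF.weightProd_nonneg z) (mul_nonneg (by positivity)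
    (Finset.sum_nonneg fun i _ => (hF.weight_pos t _ i).le))

theorem nextWeightProd_le [NeZero N] (z : Run X N M t) : F.nextWeightProd z ≤ G ^ (t + 1) := by
  rw [pow_succ]
  exact mul_le_mul (hF.weightProd_le z) (hF.sum_weight_le z) (mul_nonneg (by positivity)
    (Finset.sum_nonneg fun i _ => (hF.weight_pos t _ i).le)) (pow_nonneg
      (zero_le_one.trans hF.one_le) t)

theorem bddMeas_weightProd [NeZero N] : BddMeas fun z : Run X N M t => F.weightProd z :=
  ⟨measurable_weightProd t, G ^ t, fun z => by
    rw [abs_of_nonneg (hF.weightProd_nonneg z)]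
    exact hF.weightProd_le z⟩

theorem bddMeas_coalStat [NeZero M] (b : Fin (t + 1) → Fin 2) (k l : Fin N) :
    BddMeas fun z : Run X N M t => F.coalStat z b k l :=
  ⟨measurable_coalStat b k l, 1, fun z => by
    rw [abs_of_nonneg (coalStat_nonneg hF.pot_pos z b k l)]
    exact coalStat_le_one hF.pot_pos (NeZero.ne M) z b k l⟩

theorem bddMeas_pairEst [NeZero N] [NeZero M] (b : Fin (t + 1) → Fin 2) {φ ψ : X → ℝ}
    (hφ : BddMeas φ) (hψ : BddMeas ψ) : BddMeas fun z : Run X N M t => F.pairEst z b φ ψ := by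
  have hp : ∀ i, Measurable fun z : Run X N M t => z.particles i := fun i =>
    (measurable_pi_apply i).comp (Run.measurable_particles t)
  simp only [pairEst, div_eq_mul_inv]
  exact ((hF.bddMeas_weightProd.pow 2).mul (BddMeas.const _)).mul (BddMeas.sum fun i =>
    BddMeas.sum fun j => (hF.bddMeas_coalStat b i j).mul ((hφ.comp (hp i)).mul (hψ.comp (hp j))))

theorem bddMeas_rowMoment [NeZero N] [NeZero M] (b : Fin (t + 1) → Fin 2) :
    BddMeas fun z : Run X N M t => F.rowMoment z b :=
  (hF.bddMeas_weightProd.pow 3).mul (BddMeas.sum fun k =>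
    (BddMeas.sum fun l => hF.bddMeas_coalStat b k l).pow 2)

theorem integral_runLaw_succ [NeZero N] {f : Run X N M (t + 1) → ℝ} (hf : BddMeas f) :
    ∫ z, f z ∂F.runLaw N M (t + 1)
      = ∫ z, ∫ m, f (z.extend m) ∂F.stepKernel N M t z.particles ∂F.runLaw N M t := by
  have := hF.isMarkovKernel_stepKernel (N := N) M t
  have := hF.isProbabilityMeasure_runLaw (N := N) M t
  exact BddMeas.integral_compProd (f := fun p : Run X N M t × Move X N M => f (p.1.extend p.2))
    hf (F.runLaw N M t)
    ((F.stepKernel N M t).comap Run.particles (Run.measurable_particles t))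

theorem bddMeas_integral_stepKernel [NeZero N] {f : Run X N M (t + 1) → ℝ} (hf : BddMeas f) :
    BddMeas fun z : Run X N M t => ∫ m, f (z.extend m) ∂F.stepKernel N M t z.particles := by
  have := hF.isMarkovKernel_stepKernel (N := N) M t
  exact BddMeas.integral_kernel (f := fun p : Run X N M t × Move X N M => f (p.1.extend p.2))
    hf ((F.stepKernel N M t).comap Run.particles (Run.measurable_particles t))

/-- The new particles with their i-th backward indices have a law that depends on neither i nor M.
-/
theorem integral_stepKernel_pairs [NeZero N] (ξ : Fin N → X) (i : Fin M)
    {f : (Fin N → X × Fin N) → ℝ} (hf : BddMeas f) :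
    ∫ m, f (m.pairs i) ∂F.stepKernel N M t ξ
      = ∫ y, f y ∂(Measure.pi fun _ : Fin N => F.pairLaw t ξ) := by
  rw [← hF.map_stepKernel M t ξ i]
  exact (integral_map (measurable_pairs i).aemeasurable hf.meas.aestronglyMeasurable).symm

end Regular

end Model

/-! ### Conditional mean and variance over one step of the algorithm -/

namespace Model

variable {X : Type*} [MeasurableSpace X] {F : Model X} {G : ℝ} {N M t : ℕ}

/-- A pointwise bound for the conditional expectation of `rowMoment` after one step. -/
def rowMomentBound (F : Model X) (G : ℝ) (z : Run X N M t) (b : Fin (t + 2) → Fin 2) : ℝ :=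
  if b (Fin.last (t + 1)) = 0 then
    G ^ 3 * ((N : ℝ) ^ 2 * F.weightProd z * F.pairEst z (fun s => b s.castSucc) (fun _ => 1)
      (fun _ => 1) + F.rowMoment z (fun s => b s.castSucc))
  else (G ^ (t + 1)) ^ 3 * N

namespace Regular

variable (hF : F.Regular G) [NeZero N]
include hF

/-- The total weight inside `nextWeightProd` cancels the denominator of `normWeight`: each power of
the product pays for one normalised weight, without any lower bound on the potentials. -/
theorem nextWeightProd_mul_normWeight (z : Run X N M t) (a : Fin N) :
    F.nextWeightProd z * normWeight (F.weight t z.particles) a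
      = F.weightProd z * ((N : ℝ)⁻¹ * F.weight t z.particles a) := by
  have h : 0 < ∑ i, F.weight t z.particles i := sum_pos_of_pos (hF.weight_pos t _)
  unfold nextWeightProd normWeight
  field_simp

variable [NeZero M]

/-- The mean of the estimator after one step, in terms of a single backward index. -/
theorem integral_pairEst_extend_aux (z : Run X N M t) (b : Fin (t + 2) → Fin 2) {φ ψ : X → ℝ}
    (hφ : BddMeas φ) (hψ : BddMeas ψ) :
    ∫ m, F.pairEst (z.extend m) b φ ψ ∂F.stepKernel N M t z.particles
      = F.nextWeightProd z ^ 2 / (N : ℝ) ^ 2 *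
        ∫ y, ∑ k, ∑ l, coalUpdate (normWeight (F.weight t z.particles))
          (F.coalStat z fun s => b s.castSucc) (b (Fin.last (t + 1))) (fun k => (y k).2) k l
          * (φ (y k).1 * ψ (y l).1) ∂(Measure.pi fun _ : Fin N => F.pairLaw t z.particles) := by
  have := hF.isMarkovKernel_stepKernel (N := N) M t
  have hM : (M : ℝ) ≠ 0 := Nat.cast_ne_zero.2 (NeZero.ne M)
  set g : (Fin N → X × Fin N) → ℝ := fun y => F.nextWeightProd z ^ 2 / (N : ℝ) ^ 2 *
    ∑ k, ∑ l, coalUpdate (normWeight (F.weight t z.particles))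
      (F.coalStat z fun s => b s.castSucc) (b (Fin.last (t + 1))) (fun k => (y k).2) k l
      * (φ (y k).1 * ψ (y l).1) with hg
  have hgb : BddMeas g := (BddMeas.sum fun k => BddMeas.sum fun l =>
    bddMeas_coalUpdate_mul _ _ _ hφ hψ k l).const_mul _
  have h : ∀ m : Move X N M, F.pairEst (z.extend m) b φ ψ = (M : ℝ)⁻¹ * ∑ i, g (m.pairs i) :=
    fun m => pairEst_extend z m b φ ψ
  simp_rw [h]
  rw [integral_const_mul, integral_sum_of_bddMeas _ fun i => hgb.comp (measurable_pairs i)]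
  simp_rw [hF.integral_stepKernel_pairs z.particles _ hgb]
  rw [Finset.sum_const, Finset.card_univ, Fintype.card_fin, nsmul_eq_mul, ← mul_assoc,
    inv_mul_cancel₀ hM, one_mul, hg, integral_const_mul]

/-- The N(N-1) off-diagonal pairs against the normalisation N² give 1 - 1/N. The two factors of
`nextWeightProd` turn the normalised weights into potentials, which combine with the transitions
into `QInt`. -/
theorem integral_pairEst_extend_zero (z : Run X N M t) {b : Fin (t + 2) → Fin 2}
    (hb : b (Fin.last (t + 1)) = 0) {φ ψ : X → ℝ} (hφ : BddMeas φ) (hψ : BddMeas ψ) :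
    ∫ m, F.pairEst (z.extend m) b φ ψ ∂F.stepKernel N M t z.particles
      = (1 - (N : ℝ)⁻¹) * F.pairEst z (fun s => b s.castSucc) (F.QInt t φ) (F.QInt t ψ) := by
  have hN : (N : ℝ) ≠ 0 := Nat.cast_ne_zero.2 (NeZero.ne N)
  rw [hF.integral_pairEst_extend_aux z b hφ hψ, hb, hF.integral_coalUpdate_zero _ hφ hψ, pairEst,
    Finset.mul_sum, Finset.mul_sum, Finset.mul_sum, Finset.mul_sum]
  refine Finset.sum_congr rfl fun a _ => ?_
  rw [Finset.mul_sum, Finset.mul_sum, Finset.mul_sum, Finset.mul_sum]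
  refine Finset.sum_congr rfl fun c _ => ?_
  have ha := hF.nextWeightProd_mul_normWeight z a
  have hc := hF.nextWeightProd_mul_normWeight z c
  set T := F.coalStat z (fun s => b s.castSucc) a c
  set u := F.transInt t φ (z.particles a)
  set v := F.transInt t ψ (z.particles c)
  calc _ = (N * (N - 1) / (N : ℝ) ^ 2) * T * (u * v) *
        ((F.nextWeightProd z * normWeight (F.weight t z.particles) a)
          * (F.nextWeightProd z * normWeight (F.weight t z.particles) c)) := by ring
    _ = _ := by
      rw [ha, hc]
      simp only [QInt, weight]
      field_simp
      ring

/-- Only the N diagonal terms contribute, hence 1/N. The weight left alone in the second slot is the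
potential, that is `QInt` of the constant 1. -/
theorem integral_pairEst_extend_one (z : Run X N M t) {b : Fin (t + 2) → Fin 2}
    (hb : b (Fin.last (t + 1)) ≠ 0) {φ ψ : X → ℝ} (hφ : BddMeas φ) (hψ : BddMeas ψ) :
    ∫ m, F.pairEst (z.extend m) b φ ψ ∂F.stepKernel N M t z.particles
      = (N : ℝ)⁻¹ * F.pairEst z (fun s => b s.castSucc) (F.QInt t fun x => φ x * ψ x)
        (F.QInt t fun _ => 1) := by
  have hN : (N : ℝ) ≠ 0 := Nat.cast_ne_zero.2 (NeZero.ne N)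
  rw [hF.integral_pairEst_extend_aux z b hφ hψ, hF.integral_coalUpdate_one _ hφ hψ hb, pairEst,
    Finset.mul_sum, Finset.mul_sum, Finset.mul_sum, Finset.mul_sum]
  refine Finset.sum_congr rfl fun a _ => ?_
  rw [Finset.mul_sum, Finset.mul_sum, Finset.mul_sum, Finset.mul_sum]
  refine Finset.sum_congr rfl fun c _ => ?_
  have ha := hF.nextWeightProd_mul_normWeight z a
  have hc := hF.nextWeightProd_mul_normWeight z c
  set T := F.coalStat z (fun s => b s.castSucc) a c
  set u := F.transInt t (fun x => φ x * ψ x) (z.particles a)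
  have hone : F.QInt t (fun _ => 1) (z.particles c) = F.weight t z.particles c := by
    simp [QInt, transInt, weight]
  rw [hone]
  calc _ = (N / (N : ℝ) ^ 2) * T * u *
        ((F.nextWeightProd z * normWeight (F.weight t z.particles) a)
          * (F.nextWeightProd z * normWeight (F.weight t z.particles) c)) := by ring
    _ = _ := by
      rw [ha, hc]
      simp only [QInt, weight]
      field_simp
      try ring

theorem bddMeas_rowMomentBound (b : Fin (t + 2) → Fin 2) :
    BddMeas fun z : Run X N M t => F.rowMomentBound G z b := by
  unfold rowMomentBound
  split_ifs
  · exact (((hF.bddMeas_weightProd.const_mul _).mul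
      (hF.bddMeas_pairEst _ (BddMeas.const 1) (BddMeas.const 1))).add
        (hF.bddMeas_rowMoment _)).const_mul _
  · exact BddMeas.const _

/-- The one-step row moment, for a single backward index. -/
theorem integral_sq_coalUpdate_le (z : Run X N M t) (b : Fin (t + 2) → Fin 2) :
    F.nextWeightProd z ^ 3 * ∫ y, ∑ k, (∑ l, coalUpdate (normWeight (F.weight t z.particles))
      (F.coalStat z fun s => b s.castSucc) (b (Fin.last (t + 1))) (fun k => (y k).2) k l) ^ 2
        ∂(Measure.pi fun _ : Fin N => F.pairLaw t z.particles) ≤ F.rowMomentBound G z b := by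
  have := hF.isProbabilityMeasure_pairLaw (N := N) t z.particles
  have hN : (0 : ℝ) < N := Nat.cast_pos.2 (NeZero.pos N)
  have hG : 0 ≤ G := zero_le_one.trans hF.one_le
  have hP := hF.nextWeightProd_nonneg z
  have hp := hF.weightProd_nonneg z
  have hW : ∀ j, 0 ≤ normWeight (F.weight t z.particles) j :=
    normWeight_nonneg fun i => (hF.weight_pos t _ i).le
  have hw0 : ∀ a, 0 ≤ F.weight t z.particles a := fun a => (hF.weight_pos t _ a).le
  have hwG : ∀ a, F.weight t z.particles a ≤ G := fun a => hF.pot_le t _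
  have hT0 := coalStat_nonneg hF.pot_pos z fun s => b s.castSucc
  have hT1 := coalStat_le_one hF.pot_pos (NeZero.ne M) z fun s => b s.castSucc
  unfold rowMomentBound
  split_ifs with hb
  · rw [hb]
    refine (mul_le_mul_of_nonneg_left (hF.integral_sq_coalUpdate_zero_le z.particles hT0 hT1)
      (pow_nonneg hP 3)).trans ?_
    set T := F.coalStat z fun s => b s.castSucc
    -- Two of the three factors cancel the two normalised weights; the third is bounded by
    -- `weightProd` times G.
    have e1 : F.nextWeightProd z ^ 3 * ((N : ℝ) ^ 2 * ∑ a, ∑ c, T a c *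
        (normWeight (F.weight t z.particles) a * normWeight (F.weight t z.particles) c))
        ≤ G ^ 3 * ((N : ℝ) ^ 2 * F.weightProd z * F.pairEst z (fun s => b s.castSucc)
          (fun _ => 1) (fun _ => 1)) := by
      have h1 : F.nextWeightProd z ≤ F.weightProd z * G :=
        mul_le_mul_of_nonneg_left (hF.sum_weight_le z) hp
      calc _ = F.nextWeightProd z * ∑ a, ∑ c, (N : ℝ) ^ 2 * (T a c *
            ((F.nextWeightProd z * normWeight (F.weight t z.particles) a)
              * (F.nextWeightProd z * normWeight (F.weight t z.particles) c))) := by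
            simp only [Finset.mul_sum]
            exact Finset.sum_congr rfl fun a _ => Finset.sum_congr rfl fun c _ => by ring
        _ = F.nextWeightProd z * ∑ a, ∑ c, F.weightProd z ^ 2 * (T a c *
            (F.weight t z.particles a * F.weight t z.particles c)) := by
            simp only [hF.nextWeightProd_mul_normWeight z]
            congr 1
            refine Finset.sum_congr rfl fun a _ => Finset.sum_congr rfl fun c _ => ?_
            field_simp
        _ ≤ (F.weightProd z * G) * ∑ a, ∑ c, F.weightProd z ^ 2 * (T a c * (G * G)) := by
            refine mul_le_mul h1 (Finset.sum_le_sum fun a _ => Finset.sum_le_sum fun c _ => ?_)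
              (Finset.sum_nonneg fun a _ => Finset.sum_nonneg fun c _ => ?_) (mul_nonneg hp hG)
            · exact mul_le_mul_of_nonneg_left (mul_le_mul_of_nonneg_left
                (mul_le_mul (hwG a) (hwG c) (hw0 c) hG) (hT0 a c)) (sq_nonneg _)
            · exact mul_nonneg (sq_nonneg _) (mul_nonneg (hT0 a c) (mul_nonneg (hw0 a) (hw0 c)))
        _ = _ := by
            simp only [pairEst, mul_one]
            simp only [← Finset.mul_sum, ← Finset.sum_mul]
            field_simp
            try ring
    -- All three factors are consumed by the three normalised weights and N³ disappears. This is the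
    -- reason for the cube in `rowMoment`.
    have e2 : F.nextWeightProd z ^ 3 * ((N : ℝ) ^ 3 * ∑ a, normWeight (F.weight t z.particles) a
        * (∑ c, normWeight (F.weight t z.particles) c * T a c) ^ 2)
        ≤ G ^ 3 * F.rowMoment z fun s => b s.castSucc := by
      calc _ = ∑ a, (N : ℝ) ^ 3 * ((F.nextWeightProd z * normWeight (F.weight t z.particles) a)
            * (∑ c, (F.nextWeightProd z * normWeight (F.weight t z.particles) c) * T a c) ^ 2) := by
            simp only [Finset.mul_sum]
            refine Finset.sum_congr rfl fun a _ => ?_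
            simp only [mul_assoc, ← Finset.mul_sum]
            ring
        _ = ∑ a, F.weightProd z ^ 3 * (F.weight t z.particles a
            * (∑ c, F.weight t z.particles c * T a c) ^ 2) := by
            simp only [hF.nextWeightProd_mul_normWeight z]
            refine Finset.sum_congr rfl fun a _ => ?_
            simp only [mul_assoc, ← Finset.mul_sum]
            field_simp
        _ ≤ ∑ a, F.weightProd z ^ 3 * (G * (G * ∑ c, T a c) ^ 2) := by
            refine Finset.sum_le_sum fun a _ => mul_le_mul_of_nonneg_left ?_ (pow_nonneg hp 3)
            refine mul_le_mul (hwG a) (pow_le_pow_left₀ ?_ ?_ 2) (sq_nonneg _) hG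
            · exact Finset.sum_nonneg fun c _ => mul_nonneg (hw0 c) (hT0 a c)
            · rw [Finset.mul_sum]
              exact Finset.sum_le_sum fun c _ => mul_le_mul_of_nonneg_right (hwG c) (hT0 a c)
        _ = _ := by
            rw [rowMoment, Finset.mul_sum, Finset.mul_sum]
            exact Finset.sum_congr rfl fun a _ => by ring
    rw [mul_add, mul_add]
    exact add_le_add e1 e2
  · have hint : ∫ y, ∑ k, (∑ l, coalUpdate (normWeight (F.weight t z.particles))
        (F.coalStat z fun s => b s.castSucc) (b (Fin.last (t + 1))) (fun k => (y k).2) k l) ^ 2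
        ∂(Measure.pi fun _ : Fin N => F.pairLaw t z.particles) ≤ N := by
      refine (integral_le_of_bddMeas (BddMeas.sum fun k => (BddMeas.sum fun l =>
        bddMeas_coalUpdate _ _ _ k l).pow 2) (BddMeas.const (N : ℝ)) _ fun y =>
        sum_sq_coalUpdate_le _ _ hW (sum_normWeight (hF.weight_pos t _)) hT0 hT1 hb).trans ?_
      simp
    exact mul_le_mul (pow_le_pow_left₀ hP (hF.nextWeightProd_le z) 3) hint
      (integral_nonneg fun y => Finset.sum_nonneg fun k _ => sq_nonneg _)
      (pow_nonneg (pow_nonneg hG _) 3)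

theorem integral_rowMoment_extend_le (z : Run X N M t) (b : Fin (t + 2) → Fin 2) :
    ∫ m, F.rowMoment (z.extend m) b ∂F.stepKernel N M t z.particles
      ≤ F.rowMomentBound G z b := by
  have := hF.isMarkovKernel_stepKernel (N := N) M t
  have hM : (M : ℝ) ≠ 0 := Nat.cast_ne_zero.2 (NeZero.ne M)
  refine le_trans ?_ (hF.integral_sq_coalUpdate_le z b)
  set g : (Fin N → X × Fin N) → ℝ := fun y => ∑ k, (∑ l, coalUpdate (normWeight
    (F.weight t z.particles)) (F.coalStat z fun s => b s.castSucc) (b (Fin.last (t + 1)))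
      (fun k => (y k).2) k l) ^ 2 with hg
  have hgb : BddMeas g := BddMeas.sum fun k => (BddMeas.sum fun l =>
    bddMeas_coalUpdate _ _ _ k l).pow 2
  have hgi : ∀ i, BddMeas fun m : Move X N M => g (m.pairs i) := fun i =>
    hgb.comp (measurable_pairs i)
  -- Each row sum is an average over i, so its square is at most the average of the one-index
  -- squares.
  have hle : ∀ m : Move X N M, F.rowMoment (z.extend m) b
      ≤ F.nextWeightProd z ^ 3 * ((M : ℝ)⁻¹ * ∑ i, g (m.pairs i)) := fun m => by
    refine mul_le_mul_of_nonneg_left ?_ (pow_nonneg (hF.nextWeightProd_nonneg z) 3)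
    rw [hg, Finset.sum_comm, Finset.mul_sum]
    refine Finset.sum_le_sum fun k _ => ?_
    simp only [coalStat_extend]
    rw [← Finset.mul_sum, Finset.sum_comm]
    exact sq_mean_le _
  have hmeas : BddMeas fun m : Move X N M => F.rowMoment (z.extend m) b :=
    (hF.bddMeas_rowMoment b).comp (measurable_prodMk_left (x := z))
  refine (integral_le_of_bddMeas hmeas (((BddMeas.sum fun i => hgi i).const_mul _).const_mul _)
    _ hle).trans (le_of_eq ?_)
  rw [integral_const_mul, integral_const_mul, integral_sum_of_bddMeas _ hgi]
  simp_rw [hF.integral_stepKernel_pairs z.particles _ hgb]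
  rw [Finset.sum_const, Finset.card_univ, Fintype.card_fin, nsmul_eq_mul,
    inv_mul_cancel_left₀ hM]

/-- The conditional variance of the estimator. -/
theorem integral_sq_pairEst_extend_sub_le (z : Run X N M t) (b : Fin (t + 2) → Fin 2)
    {φ ψ : X → ℝ} (hφ : BddMeas φ) (hψ : BddMeas ψ) {C : ℝ} (hC : 0 ≤ C)
    (hφψ : ∀ x y, |φ x * ψ y| ≤ C) :
    ∫ m, (F.pairEst (z.extend m) b φ ψ
        - ∫ m', F.pairEst (z.extend m') b φ ψ ∂F.stepKernel N M t z.particles) ^ 2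
        ∂F.stepKernel N M t z.particles
      ≤ 8 * C ^ 2 * G ^ (t + 1) / (N : ℝ) ^ 4 * F.rowMomentBound G z b := by
  have := hF.isMarkovKernel_stepKernel (N := N) M t
  have := hF.isProbabilityMeasure_pairLaw (N := N) t z.particles
  have hN : (0 : ℝ) < N := Nat.cast_pos.2 (NeZero.pos N)
  have hM : (M : ℝ) ≠ 0 := Nat.cast_ne_zero.2 (NeZero.ne M)
  have hP := hF.nextWeightProd_nonneg z
  set S : (Fin N → X × Fin N) → ℝ := fun y => ∑ k, ∑ l, coalUpdate (normWeight
    (F.weight t z.particles)) (F.coalStat z fun s => b s.castSucc) (b (Fin.last (t + 1)))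
      (fun k => (y k).2) k l * (φ (y k).1 * ψ (y l).1) with hS
  set e : ℝ := ∫ y, S y ∂(Measure.pi fun _ : Fin N => F.pairLaw t z.particles) with he
  set D : ℝ := ∫ y, ∑ k, (∑ l, coalUpdate (normWeight (F.weight t z.particles))
      (F.coalStat z fun s => b s.castSucc) (b (Fin.last (t + 1))) (fun k => (y k).2) k l) ^ 2
        ∂(Measure.pi fun _ : Fin N => F.pairLaw t z.particles) with hD
  have hD0 : 0 ≤ D := integral_nonneg fun y => Finset.sum_nonneg fun k _ => sq_nonneg _
  have hSb : BddMeas S := BddMeas.sum fun k => BddMeas.sum fun l =>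
    bddMeas_coalUpdate_mul _ _ _ hφ hψ k l
  have hvar : ∫ y, (S y - e) ^ 2 ∂(Measure.pi fun _ : Fin N => F.pairLaw t z.particles)
      ≤ 8 * C ^ 2 * D :=
    integral_sq_coalUpdate_sub_le (F.pairLaw t z.particles) hφ hψ hC hφψ
      (normWeight_nonneg fun i => (hF.weight_pos t _ i).le)
      (coalStat_nonneg hF.pot_pos z _) (coalStat_symm z _) _
  have hSi : ∀ i, BddMeas fun m : Move X N M => (S (m.pairs i) - e) ^ 2 := fun i =>
    ((hSb.sub (BddMeas.const e)).pow 2).comp (measurable_pairs i)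
  set c : ℝ := F.nextWeightProd z ^ 2 / (N : ℝ) ^ 2 with hc
  rw [hF.integral_pairEst_extend_aux z b hφ hψ]
  -- All indices have the same mean `e`, so the deviation is an average of one-index deviations and
  -- Jensen's inequality applies.
  have hle : ∀ m : Move X N M, (F.pairEst (z.extend m) b φ ψ - c * e) ^ 2
      ≤ c ^ 2 * ((M : ℝ)⁻¹ * ∑ i, (S (m.pairs i) - e) ^ 2) := fun m => by
    have h1 : F.pairEst (z.extend m) b φ ψ - c * e
        = c * ((M : ℝ)⁻¹ * ∑ i, (S (m.pairs i) - e)) := by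
      rw [pairEst_extend, ← Finset.mul_sum, Finset.sum_sub_distrib, mul_sub ((M : ℝ)⁻¹)]
      simp only [Finset.sum_const, Finset.card_univ, Fintype.card_fin, nsmul_eq_mul]
      rw [inv_mul_cancel_left₀ hM]
      ring
    rw [h1, mul_pow]
    exact mul_le_mul_of_nonneg_left (sq_mean_le _) (sq_nonneg c)
  have hmeas : BddMeas fun m : Move X N M => (F.pairEst (z.extend m) b φ ψ - c * e) ^ 2 :=
    (((hF.bddMeas_pairEst b hφ hψ).comp (measurable_prodMk_left (x := z))).sub
      (BddMeas.const _)).pow 2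
  refine (integral_le_of_bddMeas hmeas (((BddMeas.sum fun i => hSi i).const_mul _).const_mul _)
    _ hle).trans ?_
  rw [integral_const_mul, integral_const_mul, integral_sum_of_bddMeas _ hSi]
  simp_rw [hF.integral_stepKernel_pairs z.particles _ ((hSb.sub (BddMeas.const e)).pow 2)]
  rw [Finset.sum_const, Finset.card_univ, Fintype.card_fin, nsmul_eq_mul, inv_mul_cancel_left₀ hM]
  have hrow := hF.integral_sq_coalUpdate_le z b
  have hPG := hF.nextWeightProd_le z
  -- Of the four factors `nextWeightProd` in c², three go to the row moment and the fourth is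
  -- bounded by a power of G.
  calc _ ≤ c ^ 2 * (8 * C ^ 2 * D) := mul_le_mul_of_nonneg_left hvar (sq_nonneg c)
    _ = 8 * C ^ 2 / (N : ℝ) ^ 4 * (F.nextWeightProd z * (F.nextWeightProd z ^ 3 * D)) := by
      rw [hc]
      field_simp
      try ring
    _ ≤ 8 * C ^ 2 / (N : ℝ) ^ 4 * (G ^ (t + 1) * F.rowMomentBound G z b) := by
      refine mul_le_mul_of_nonneg_left ?_ (by positivity)
      exact mul_le_mul hPG hrow (mul_nonneg (pow_nonneg hP 3) hD0) (hP.trans hPG)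
    _ = _ := by ring

/-- One step of `γ_t^N`. -/
theorem integral_gammaN_extend_le (z : Run X N M t) {φ : X → ℝ} (hφ : BddMeas φ) {C : ℝ}
    (hC : 0 ≤ C) (hφC : ∀ x, |φ x| ≤ C) :
    ∫ m, (F.gammaN (z.extend m) φ - F.gammaN z (F.QInt t φ)) ^ 2 ∂F.stepKernel N M t z.particles
      ≤ (G ^ (t + 1)) ^ 2 * (8 * C ^ 2) / N := by
  have := hF.isProbabilityMeasure_pairLaw (N := N) t z.particles
  have hN : (0 : ℝ) < N := Nat.cast_pos.2 (NeZero.pos N)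
  set e : ℝ := ∫ p, φ p.1 ∂F.pairLaw t z.particles with he
  have hφ1 : BddMeas fun p : X × Fin N => φ p.1 := hφ.comp measurable_fst
  have hmean : F.gammaN z (F.QInt t φ) = F.nextWeightProd z * e := by
    have h1 := hF.integral_pairLaw_mul (t := t) z.particles hφ fun _ => 1
    simp only [one_mul] at h1
    rw [he, h1, Finset.mul_sum, gammaN, etaN, Finset.mul_sum, Finset.mul_sum]
    refine Finset.sum_congr rfl fun a _ => ?_
    rw [← mul_assoc (F.nextWeightProd z), hF.nextWeightProd_mul_normWeight]
    simp only [QInt, weight]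
    ring
  set g : (Fin N → X × Fin N) → ℝ := fun y => (∑ k, φ (y k).1 - N * e) ^ 2 with hg
  have hgb : BddMeas g := ((BddMeas.sum fun k => hφ1.comp (measurable_pi_apply k)).sub
    (BddMeas.const _)).pow 2
  -- Only the particle components of `m.pairs 0` are used; any backward index would serve.
  have h : ∀ m : Move X N M, (F.gammaN (z.extend m) φ - F.gammaN z (F.QInt t φ)) ^ 2
      = (F.nextWeightProd z / N) ^ 2 * g (m.pairs 0) := fun m => by
    rw [hmean, hg, gammaN, etaN, weightProd_extend]
    simp only [Run.particles_extend, Move.pairs]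
    field_simp
  simp_rw [h]
  rw [integral_const_mul, hF.integral_stepKernel_pairs z.particles _ hgb]
  have hv := integral_sq_sum_eval_sub_le (ι := Fin N) (F.pairLaw t z.particles) hφ1 hC
    fun p => hφC p.1
  rw [Fintype.card_fin] at hv
  calc _ ≤ (F.nextWeightProd z / N) ^ 2 * (8 * C ^ 2 * N) :=
        mul_le_mul_of_nonneg_left hv (sq_nonneg _)
    _ = F.nextWeightProd z ^ 2 * (8 * C ^ 2) / N := by field_simp
    _ ≤ _ := by
      refine div_le_div_of_nonneg_right (mul_le_mul_of_nonneg_right ?_ (by positivity)) hN.le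
      exact pow_le_pow_left₀ (hF.nextWeightProd_nonneg z) (hF.nextWeightProd_le z) 2

end Regular

end Model

namespace Model

variable {X : Type*} [MeasurableSpace X] {F : Model X} {G : ℝ} {N M t : ℕ}

/-! ### Integrals of the Feynman-Kac model -/

theorem Q_apply (F : Model X) (t : ℕ) (x : X) :
    F.Q t x = ENNReal.ofReal (F.pot t x) • F.trans t x := by
  rw [Q, Kernel.withDensity_apply _ ((F.measurable_pot t).comp measurable_fst).ennreal_ofReal,
    withDensity_const]

theorem integral_Q (F : Model X) (t : ℕ) (φ : X → ℝ) (x : X) :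
    ∫ y, φ y ∂F.Q t x = F.QInt t φ x := by
  rw [Q_apply, integral_smul_measure, ENNReal.toReal_ofReal (F.pot_nonneg t x)]
  rfl

namespace Regular

variable (hF : F.Regular G)
include hF

theorem isFiniteKernel_Q (t : ℕ) : IsFiniteKernel (F.Q t) := by
  refine ⟨ENNReal.ofReal G, ENNReal.ofReal_lt_top, fun x => ?_⟩
  rw [Q_apply]
  simpa using ENNReal.ofReal_le_ofReal (hF.pot_le t x)

theorem isFiniteKernel_Qmarg (s n : ℕ) : IsFiniteKernel (F.Qmarg s n) := by
  induction n with
  | zero => exact inferInstanceAs (IsFiniteKernel Kernel.id)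
  | succ n ih =>
    have := hF.isFiniteKernel_Q (s + n)
    exact inferInstanceAs (IsFiniteKernel (F.Q (s + n) ∘ₖ F.Qmarg s n))

theorem isFiniteMeasure_γ (t : ℕ) : IsFiniteMeasure (F.γ t) := by
  induction t with
  | zero => exact inferInstanceAs (IsFiniteMeasure F.init)
  | succ t ih =>
    have := hF.isFiniteKernel_Q t
    exact inferInstanceAs (IsFiniteMeasure (F.Q t ∘ₘ F.γ t))

theorem integral_Qmarg_succ (s n : ℕ) {φ : X → ℝ} (hφ : BddMeas φ) (x : X) :
    ∫ y, φ y ∂F.Qmarg s (n + 1) x = ∫ y, F.QInt (s + n) φ y ∂F.Qmarg s n x := by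
  have := hF.isFiniteKernel_Qmarg s n
  have := hF.isFiniteKernel_Q (s + n)
  simp_rw [← integral_Q]
  exact Kernel.integral_comp (η := F.Q (s + n)) (κ := F.Qmarg s n) (a := x) (hφ.integrable _)

theorem integral_γ_succ (t : ℕ) {φ : X → ℝ} (hφ : BddMeas φ) :
    ∫ x, φ x ∂F.γ (t + 1) = ∫ x, F.QInt t φ x ∂F.γ t := by
  have := hF.isFiniteMeasure_γ t
  have := hF.isFiniteKernel_Q t
  simp_rw [← integral_Q]
  change ∫ x, φ x ∂(F.Q t ∘ₘ F.γ t) = _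
  rw [Measure.comp_eq_comp_const_apply]
  exact Kernel.integral_comp (η := F.Q t) (κ := Kernel.const Unit (F.γ t)) (a := ())
    (hφ.integrable _)

end Regular

/-- The limits of `N` times the estimators `pairEst`, for `b ≠ 0`. -/
def pairLimit (F : Model X) : ∀ t, (Fin (t + 1) → Fin 2) → (X → ℝ) → (X → ℝ) → ℝ
  | 0, b, φ, ψ => if b 0 = 0 then 0 else ∫ x, φ x * ψ x ∂F.γ 0
  | t + 1, b, φ, ψ =>
    if b (Fin.last (t + 1)) = 0 then pairLimit F t (fun s => b s.castSucc) (F.QInt t φ) (F.QInt t ψ)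
    else if (fun s => b s.castSucc) = (0 : Fin (t + 1) → Fin 2) then
      (∫ x, φ x * ψ x ∂F.γ (t + 1)) * ∫ _, 1 ∂F.γ (t + 1)
    else 0

theorem pairLimit_zero (t : ℕ) (φ ψ : X → ℝ) : F.pairLimit t 0 φ ψ = 0 := by
  induction t generalizing φ ψ with
  | zero => simp [pairLimit]
  | succ t ih =>
    rw [pairLimit]
    exact (if_pos rfl).trans (ih _ _)

/-- Only words b with a single one contribute, its position being s. A last bit 0 transports both
functions by Q, lengthening `Qmarg` by one step; a last bit 1 leaves only the zero word before it
and gives the term s = t + 1. -/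
theorem Regular.sum_pairLimit (hF : F.Regular G) (t : ℕ) {φ ψ : X → ℝ} (hφ : BddMeas φ)
    (hψ : BddMeas ψ) :
    ∑ b, F.pairLimit t b φ ψ = ∑ s ∈ Finset.range (t + 1), (∫ _, 1 ∂F.γ s)
      * ∫ x, (∫ y, φ y ∂F.Qmarg s (t - s) x) * (∫ y, ψ y ∂F.Qmarg s (t - s) x) ∂F.γ s := by
  have hid : ∀ (s : ℕ) {χ : X → ℝ}, BddMeas χ → ∀ x, ∫ y, χ y ∂F.Qmarg s 0 x = χ x :=
    fun s χ hχ x => by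
      change ∫ y, χ y ∂(Kernel.id : Kernel X X) x = χ x
      rw [Kernel.id_apply]
      exact integral_dirac' _ _ hχ.meas.stronglyMeasurable
  induction t generalizing φ ψ with
  | zero =>
    rw [← (Equiv.funUnique (Fin 1) (Fin 2)).symm.sum_comp]
    simp only [Fin.sum_univ_two, pairLimit, zero_add, Finset.range_one, Finset.sum_singleton,
      Nat.sub_self, hid 0 hφ, hid 0 hψ]
    have h1 : ∫ _, (1 : ℝ) ∂F.γ 0 = 1 := by
      change ∫ _, (1 : ℝ) ∂F.init = 1
      simp
    rw [h1]
    simp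
  | succ t ih =>
    rw [sum_fin_succ_pi, Fin.sum_univ_two, Finset.sum_range_succ]
    simp only [pairLimit, Fin.snoc_last, Fin.snoc_castSucc, if_true, one_ne_zero, if_false,
      Finset.sum_ite_eq', Finset.mem_univ, Nat.sub_self, hid (t + 1) hφ, hid (t + 1) hψ]
    rw [ih (hF.bddMeas_QInt hφ) (hF.bddMeas_QInt hψ), mul_comm (∫ x, φ x * ψ x ∂F.γ (t + 1))]
    congr 1
    refine Finset.sum_congr rfl fun s hs => ?_
    obtain ⟨n, rfl⟩ := Nat.exists_eq_add_of_le (Nat.lt_succ_iff.1 (Finset.mem_range.1 hs))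
    rw [show s + n + 1 - s = n + 1 by omega, show s + n - s = n by omega]
    simp_rw [hF.integral_Qmarg_succ s n hφ, hF.integral_Qmarg_succ s n hψ]

/-! ### Moment bounds, uniformly in the number of particles -/

/-- The run without its last move. -/
def _root_.Paris.Run.prev (z : Run X N M (t + 1)) : Run X N M t := z.1

theorem measurable_prev : Measurable (Run.prev : Run X N M (t + 1) → Run X N M t) :=
  measurable_fst

theorem castSucc_ne_zero {b : Fin (t + 2) → Fin 2} (hb : b ≠ 0) (hl : b (Fin.last (t + 1)) = 0) :
    (fun s => b s.castSucc) ≠ (0 : Fin (t + 1) → Fin 2) := fun h => hb <| by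
  funext s
  induction s using Fin.lastCases with
  | last => exact hl
  | cast s => exact congrFun h s

theorem abs_pairEst_le (hg : ∀ t x, 0 < F.pot t x) (z : Run X N M t) (b : Fin (t + 1) → Fin 2)
    {φ ψ : X → ℝ} {C : ℝ} (hφψ : ∀ x y, |φ x * ψ y| ≤ C) :
    |F.pairEst z b φ ψ| ≤ C * F.pairEst z b (fun _ => 1) (fun _ => 1) := by
  simp only [pairEst, mul_one]
  rw [abs_mul, abs_of_nonneg (by positivity), mul_left_comm]
  refine mul_le_mul_of_nonneg_left ?_ (by positivity)
  rw [Finset.mul_sum]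
  refine (Finset.abs_sum_le_sum_abs _ _).trans (Finset.sum_le_sum fun i _ => ?_)
  rw [Finset.mul_sum]
  refine (Finset.abs_sum_le_sum_abs _ _).trans (Finset.sum_le_sum fun j _ => ?_)
  rw [abs_mul, abs_of_nonneg (coalStat_nonneg hg z b i j), mul_comm]
  exact mul_le_mul_of_nonneg_right (hφψ _ _) (coalStat_nonneg hg z b i j)

theorem pairEst_one_nonneg (hg : ∀ t x, 0 < F.pot t x) (z : Run X N M t)
    (b : Fin (t + 1) → Fin 2) : 0 ≤ F.pairEst z b (fun _ => 1) (fun _ => 1) := by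
  simp only [pairEst, mul_one]
  exact mul_nonneg (by positivity) (Finset.sum_nonneg fun i _ => Finset.sum_nonneg fun j _ =>
    coalStat_nonneg hg z b i j)

theorem sum_pairEst (hg : ∀ t x, 0 < F.pot t x) (hM : M ≠ 0) (z : Run X N M t) (φ ψ : X → ℝ) :
    ∑ b, F.pairEst z b φ ψ = F.gammaN z φ * F.gammaN z ψ := by
  simp only [pairEst, gammaN, etaN]
  rw [← Finset.mul_sum, Finset.sum_comm]
  have h : ∀ i, ∑ b, ∑ j, F.coalStat z b i j * (φ (z.particles i) * ψ (z.particles j))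
      = ∑ j, φ (z.particles i) * ψ (z.particles j) := fun i => by
    rw [Finset.sum_comm]
    refine Finset.sum_congr rfl fun j _ => ?_
    rw [← Finset.sum_mul, sum_coalStat hg hM z i j, one_mul]
  simp_rw [h]
  rw [← Finset.sum_mul_sum]
  ring

theorem pairEst_time_zero (z : Run X N M 0) {b : Fin 1 → Fin 2} (hb : b 0 ≠ 0) (φ ψ : X → ℝ) :
    F.pairEst z b φ ψ = (N : ℝ)⁻¹ * F.gammaN z fun x => φ x * ψ x := by
  simp only [pairEst, gammaN, etaN, weightProd_zero, coalStat_zero, hb, if_false]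
  simp
  ring

theorem fin_one_ne_zero {b : Fin 1 → Fin 2} (hb : b ≠ 0) : b 0 ≠ 0 := fun h => hb <| by
  funext s
  rw [Subsingleton.elim s 0, h]
  rfl

namespace Regular

variable (hF : F.Regular G)
include hF

theorem integral_prev [NeZero N] {f : Run X N M t → ℝ} (hf : BddMeas f) :
    ∫ z, f z.prev ∂F.runLaw N M (t + 1) = ∫ z, f z ∂F.runLaw N M t := by
  have := hF.isMarkovKernel_stepKernel (N := N) M t
  rw [hF.integral_runLaw_succ (hf.comp measurable_prev)]
  refine integral_congr_ae (ae_of_all _ fun z => ?_)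
  change ∫ _, f z ∂F.stepKernel N M t z.particles = f z
  simp

theorem bddMeas_gammaN [NeZero N] {φ : X → ℝ} (hφ : BddMeas φ) :
    BddMeas fun z : Run X N M t => F.gammaN z φ :=
  hF.bddMeas_weightProd.mul ((BddMeas.sum fun i =>
    hφ.comp ((measurable_pi_apply i).comp (Run.measurable_particles t))).const_mul _)

variable [NeZero M]

variable (M) in
-- A bit 0 costs at most a factor G² in mean, by the recursion. The latest bit 1 supplies an
-- explicit 1/N, and what remains is bounded, being dominated by one non-negative term of a sum
-- equal to the squared weight product.
theorem exists_integral_pairEst_le (t : ℕ) (b : Fin (t + 1) → Fin 2) (hb : b ≠ 0) :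
    ∃ C : ℝ, 0 ≤ C ∧ ∀ N : ℕ, NeZero N →
      ∫ z, F.pairEst z b (fun _ => 1) (fun _ => 1) ∂F.runLaw N M t ≤ C / N := by
  have hG0 : 0 ≤ G := zero_le_one.trans hF.one_le
  have hone : ∀ t x, F.QInt t (fun _ => 1) x = F.pot t x := fun t x => by simp [QInt, transInt]
  have hGG : ∀ t x y, |F.QInt t (fun _ => 1) x * F.QInt t (fun _ => 1) y| ≤ G ^ 2 := by
    intro t x y
    rw [hone, hone, abs_of_nonneg (mul_nonneg (F.pot_nonneg t x) (F.pot_nonneg t y)), pow_two]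
    exact mul_le_mul (hF.pot_le t x) (hF.pot_le t y) (F.pot_nonneg t y) hG0
  induction t with
  | zero =>
    refine ⟨1, zero_le_one, fun N _ => ?_⟩
    have := hF.isProbabilityMeasure_runLaw (N := N) M 0
    have hN : (N : ℝ) ≠ 0 := Nat.cast_ne_zero.2 (NeZero.ne N)
    simp_rw [pairEst_time_zero _ (fin_one_ne_zero hb)]
    simp [gammaN, etaN, weightProd_zero, hN]
  | succ t ih =>
    by_cases hl : b (Fin.last (t + 1)) = 0
    · obtain ⟨C, hC, h⟩ := ih _ (castSucc_ne_zero hb hl)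
      refine ⟨G ^ 2 * C, by positivity, fun N _ => ?_⟩
      have := hF.isProbabilityMeasure_runLaw (N := N) M t
      have hN : (1 : ℝ) ≤ N := Nat.one_le_cast.2 (NeZero.pos N)
      rw [hF.integral_runLaw_succ (hF.bddMeas_pairEst b (BddMeas.const 1) (BddMeas.const 1))]
      simp_rw [hF.integral_pairEst_extend_zero _ hl (BddMeas.const 1) (BddMeas.const 1)]
      have hQ := hF.bddMeas_QInt (t := t) (BddMeas.const 1)
      refine (integral_le_of_bddMeas ((hF.bddMeas_pairEst _ hQ hQ).const_mul _)
        ((hF.bddMeas_pairEst (fun s => b s.castSucc) (BddMeas.const 1)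
          (BddMeas.const 1)).const_mul (G ^ 2)) _ fun z => ?_).trans ?_
      · have h1 := abs_pairEst_le hF.pot_pos z (fun s => b s.castSucc) (hGG t)
        have h0 : (0 : ℝ) ≤ 1 - (N : ℝ)⁻¹ := sub_nonneg.2 (inv_le_one_of_one_le₀ hN)
        have h2 : (1 : ℝ) - (N : ℝ)⁻¹ ≤ 1 := sub_le_self _ (by positivity)
        calc _ ≤ (1 - (N : ℝ)⁻¹) * |F.pairEst z (fun s => b s.castSucc) (F.QInt t fun _ => 1)
              (F.QInt t fun _ => 1)| := mul_le_mul_of_nonneg_left (le_abs_self _) h0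
          _ ≤ _ := (mul_le_of_le_one_left (abs_nonneg _) h2).trans h1
      · rw [integral_const_mul, mul_div_assoc]
        exact mul_le_mul_of_nonneg_left (h N inferInstance) (by positivity)
    · refine ⟨G ^ 2 * (G ^ t) ^ 2, by positivity, fun N _ => ?_⟩
      have := hF.isProbabilityMeasure_runLaw (N := N) M t
      have hN : (0 : ℝ) < N := Nat.cast_pos.2 (NeZero.pos N)
      rw [hF.integral_runLaw_succ (hF.bddMeas_pairEst b (BddMeas.const 1) (BddMeas.const 1))]
      simp_rw [hF.integral_pairEst_extend_one _ hl (BddMeas.const 1) (BddMeas.const 1), mul_one]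
      have hQ := hF.bddMeas_QInt (t := t) (BddMeas.const 1)
      rw [integral_const_mul, div_eq_inv_mul]
      refine mul_le_mul_of_nonneg_left ?_ (by positivity)
      refine (integral_le_of_bddMeas (hF.bddMeas_pairEst _ hQ hQ)
        (BddMeas.const (G ^ 2 * (G ^ t) ^ 2)) _ fun z => ?_).trans (by simp)
      refine (le_abs_self _).trans ((abs_pairEst_le hF.pot_pos z (fun s => b s.castSucc)
        (hGG t)).trans (mul_le_mul_of_nonneg_left ?_ (by positivity)))
      calc F.pairEst z (fun s => b s.castSucc) (fun _ => 1) (fun _ => 1)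
          ≤ ∑ b, F.pairEst z b (fun _ => 1) (fun _ => 1) :=
            Finset.single_le_sum (f := fun b => F.pairEst z b (fun _ => 1) (fun _ => 1))
              (fun b _ => pairEst_one_nonneg hF.pot_pos z b) (Finset.mem_univ _)
        _ = F.weightProd z ^ 2 := by
            rw [sum_pairEst hF.pot_pos (NeZero.ne M)]
            simp [gammaN, etaN, hN.ne', pow_two]
        _ ≤ _ := pow_le_pow_left₀ (hF.weightProd_nonneg z) (hF.weightProd_le z) 2

/-- The term N² `pairEst` is O(N) since `pairEst` is O(1/N) in mean. The bound on `rowMoment` is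
kept as a hypothesis because this serves both inside the induction that proves it and afterwards, in
the variance estimate of `meanLim_mul_pairEst`. -/
theorem exists_integral_rowMomentBound_le (b : Fin (t + 2) → Fin 2) (hb : b ≠ 0)
    (ih : ∀ b : Fin (t + 1) → Fin 2, b ≠ 0 → ∃ C : ℝ, 0 ≤ C ∧ ∀ N : ℕ, NeZero N →
      ∫ z, F.rowMoment z b ∂F.runLaw N M t ≤ C * N) :
    ∃ C : ℝ, 0 ≤ C ∧ ∀ N : ℕ, NeZero N →
      ∫ z, F.rowMomentBound G z b ∂F.runLaw N M t ≤ C * N := by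
  have hG0 : 0 ≤ G := zero_le_one.trans hF.one_le
  unfold rowMomentBound
  split_ifs with hl
  · obtain ⟨C, hC, h⟩ := ih _ (castSucc_ne_zero hb hl)
    obtain ⟨C', hC', h'⟩ := hF.exists_integral_pairEst_le M t _ (castSucc_ne_zero hb hl)
    refine ⟨G ^ 3 * (G ^ t * C' + C), by positivity, fun N _ => ?_⟩
    have := hF.isProbabilityMeasure_runLaw (N := N) M t
    have hN : (0 : ℝ) < N := Nat.cast_pos.2 (NeZero.pos N)
    have hq := hF.bddMeas_pairEst (N := N) (M := M) (fun s => b s.castSucc) (BddMeas.const 1)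
      (BddMeas.const 1)
    have hr := hF.bddMeas_rowMoment (N := N) (M := M) fun s => b s.castSucc
    have h1 : ∀ z : Run X N M t, G ^ 3 * ((N : ℝ) ^ 2 * F.weightProd z * F.pairEst z
        (fun s => b s.castSucc) (fun _ => 1) (fun _ => 1) + F.rowMoment z fun s => b s.castSucc)
        ≤ G ^ 3 * (((N : ℝ) ^ 2 * G ^ t) * F.pairEst z (fun s => b s.castSucc) (fun _ => 1)
          (fun _ => 1) + F.rowMoment z fun s => b s.castSucc) := fun z => by
      refine mul_le_mul_of_nonneg_left (add_le_add ?_ le_rfl) (by positivity)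
      exact mul_le_mul_of_nonneg_right (mul_le_mul_of_nonneg_left (hF.weightProd_le z)
        (by positivity)) (pairEst_one_nonneg hF.pot_pos z _)
    refine (integral_le_of_bddMeas ((((hF.bddMeas_weightProd.const_mul _).mul hq).add
      hr).const_mul _) (((hq.const_mul _).add hr).const_mul _) _ h1).trans ?_
    rw [integral_const_mul, integral_add ((hq.const_mul _).integrable _) (hr.integrable _),
      integral_const_mul, mul_assoc (G ^ 3)]
    refine mul_le_mul_of_nonneg_left ?_ (pow_nonneg hG0 3)
    calc _ ≤ (N : ℝ) ^ 2 * G ^ t * (C' / N) + C * N :=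
          add_le_add (mul_le_mul_of_nonneg_left (h' N inferInstance) (by positivity))
            (h N inferInstance)
      _ = _ := by field_simp
  · refine ⟨(G ^ (t + 1)) ^ 3, by positivity, fun N _ => ?_⟩
    have := hF.isProbabilityMeasure_runLaw (N := N) M t
    simp

variable (M) in
theorem exists_integral_rowMoment_le (t : ℕ) (b : Fin (t + 1) → Fin 2) (hb : b ≠ 0) :
    ∃ C : ℝ, 0 ≤ C ∧ ∀ N : ℕ, NeZero N →
      ∫ z, F.rowMoment z b ∂F.runLaw N M t ≤ C * N := by
  induction t with
  | zero =>
    refine ⟨1, zero_le_one, fun N _ => ?_⟩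
    have := hF.isProbabilityMeasure_runLaw (N := N) M 0
    simp [rowMoment, weightProd_zero, coalStat_zero, fin_one_ne_zero hb]
  | succ t ih =>
    obtain ⟨C, hC, h⟩ := hF.exists_integral_rowMomentBound_le b hb ih
    refine ⟨C, hC, fun N _ => ?_⟩
    have := hF.isProbabilityMeasure_runLaw (N := N) M t
    rw [hF.integral_runLaw_succ (hF.bddMeas_rowMoment b)]
    exact (integral_le_of_bddMeas (hF.bddMeas_integral_stepKernel (hF.bddMeas_rowMoment b))
      (hF.bddMeas_rowMomentBound b) _ fun z => hF.integral_rowMoment_extend_le z b).trans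
        (h N inferInstance)

variable (M) in
-- Insert γ_t^N(Qφ) between γ_{t+1}^N(φ) and γ_{t+1}(φ) = γ_t(Qφ): the first gap is one conditional
-- i.i.d. fluctuation, the second is the induction hypothesis at Qφ.
theorem exists_integral_sq_gammaN_sub_le (t : ℕ) {φ : X → ℝ} (hφ : BddMeas φ) :
    ∃ C : ℝ, 0 ≤ C ∧ ∀ N : ℕ, NeZero N →
      ∫ z, (F.gammaN z φ - ∫ x, φ x ∂F.γ t) ^ 2 ∂F.runLaw N M t ≤ C / N := by
  induction t generalizing φ with
  | zero =>
    obtain ⟨C, hC⟩ := hφ.bdd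
    refine ⟨8 * |C| ^ 2, by positivity, fun N _ => ?_⟩
    have hN : (0 : ℝ) < N := Nat.cast_pos.2 (NeZero.pos N)
    have h := integral_sq_sum_eval_sub_le (ι := Fin N) F.init hφ (abs_nonneg C)
      fun x => (hC x).trans (le_abs_self C)
    rw [Fintype.card_fin] at h
    have e : ∀ y : Fin N → X, (F.gammaN (M := M) (t := 0) y φ - ∫ x, φ x ∂F.γ 0) ^ 2
        = ((N : ℝ) ^ 2)⁻¹ * (∑ k, φ (y k) - N * ∫ x, φ x ∂F.init) ^ 2 := fun y => by
      change ((1 : ℝ) * ((N : ℝ)⁻¹ * ∑ k, φ (y k)) - ∫ x, φ x ∂F.init) ^ 2 = _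
      field_simp
    change ∫ y : Fin N → X, (F.gammaN (M := M) (t := 0) y φ - ∫ x, φ x ∂F.γ 0) ^ 2
      ∂(Measure.pi fun _ => F.init) ≤ _
    simp_rw [e]
    rw [integral_const_mul]
    calc _ ≤ ((N : ℝ) ^ 2)⁻¹ * (8 * |C| ^ 2 * N) := mul_le_mul_of_nonneg_left h (by positivity)
      _ = _ := by field_simp
  | succ t ih =>
    obtain ⟨C, hC⟩ := hφ.bdd
    have hQ := hF.bddMeas_QInt (t := t) hφ
    obtain ⟨K, hK, h⟩ := ih hQ
    set A : ℝ := (G ^ (t + 1)) ^ 2 * (8 * |C| ^ 2) with hA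
    refine ⟨2 * A + 2 * K, by positivity, fun N _ => ?_⟩
    have := hF.isProbabilityMeasure_runLaw (N := N) M t
    have := hF.isProbabilityMeasure_runLaw (N := N) M (t + 1)
    set c := ∫ x, F.QInt t φ x ∂F.γ t with hc
    rw [hF.integral_γ_succ t hφ, ← hc]
    have hg := hF.bddMeas_gammaN (N := N) (M := M) (t := t + 1) hφ
    have hg' := hF.bddMeas_gammaN (N := N) (M := M) (t := t) hQ
    have hd := (hg.sub (hg'.comp measurable_prev)).pow 2
    have hd' := (hg'.sub (BddMeas.const c)).pow 2
    have hle : ∀ z : Run X N M (t + 1), (F.gammaN z φ - c) ^ 2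
        ≤ 2 * (F.gammaN z φ - F.gammaN z.prev (F.QInt t φ)) ^ 2
          + 2 * (F.gammaN z.prev (F.QInt t φ) - c) ^ 2 := fun z => by
      nlinarith [sq_nonneg ((F.gammaN z φ - F.gammaN z.prev (F.QInt t φ))
        - (F.gammaN z.prev (F.QInt t φ) - c))]
    refine (integral_le_of_bddMeas ((hg.sub (BddMeas.const c)).pow 2)
      ((hd.const_mul 2).add ((hd'.comp measurable_prev).const_mul 2)) _ hle).trans ?_
    rw [integral_add ((hd.const_mul 2).integrable _)
      (((hd'.comp measurable_prev).const_mul 2).integrable _), integral_const_mul,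
      integral_const_mul, hF.integral_prev hd', hF.integral_runLaw_succ hd, add_div,
      mul_div_assoc 2 A, mul_div_assoc 2 K]
    refine add_le_add (mul_le_mul_of_nonneg_left ?_ zero_le_two)
      (mul_le_mul_of_nonneg_left (h N inferInstance) zero_le_two)
    refine (integral_le_of_bddMeas (hF.bddMeas_integral_stepKernel hd) (BddMeas.const (A / N)) _
      fun z => ?_).trans (by simp)
    exact hF.integral_gammaN_extend_le z hφ (abs_nonneg C) fun x => (hC x).trans (le_abs_self C)

end Regular

end Model

/-! ### Elementary limits and convergence in mean -/

theorem BddMeas.exists_abs_mul_le {X : Type*} [MeasurableSpace X] {φ ψ : X → ℝ} (hφ : BddMeas φ) (hψ : BddMeas ψ) :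
    ∃ C : ℝ, 0 ≤ C ∧ ∀ x y, |φ x * ψ y| ≤ C := by
  obtain ⟨C, hC⟩ := hφ.bdd
  obtain ⟨D, hD⟩ := hψ.bdd
  refine ⟨|C| * |D|, by positivity, fun x y => ?_⟩
  rw [abs_mul]
  exact mul_le_mul ((hC x).trans (le_abs_self C)) ((hD y).trans (le_abs_self D)) (abs_nonneg _)
    (abs_nonneg _)

theorem tendsto_sqrt_div_natCast (C : ℝ) : Tendsto (fun N : ℕ => √(C / N)) atTop (𝓝 0) := by
  simpa using (tendsto_const_div_atTop_nhds_zero_nat C).sqrt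

theorem tendsto_one_sub_inv_natCast :
    Tendsto (fun N : ℕ => (1 : ℝ) - (N : ℝ)⁻¹) atTop (𝓝 1) := by
  simpa using (tendsto_inv_atTop_nhds_zero_nat (𝕜 := ℝ)).const_sub 1

/-- With r = N/(N-1) one has r - 1 = 1/(N-1), so the geometric sum gives N(1 - rⁿ) = -r(1 + r + ⋯ +
rⁿ⁻¹). -/
theorem tendsto_mul_one_sub_pow (n : ℕ) :
    Tendsto (fun N : ℕ => (N : ℝ) * (1 - ((N : ℝ) / ((N : ℝ) - 1)) ^ n)) atTop (𝓝 (-n)) := by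
  have hr : Tendsto (fun N : ℕ => (N : ℝ) / ((N : ℝ) - 1)) atTop (𝓝 1) := by
    have h := tendsto_one_sub_inv_natCast.inv₀ one_ne_zero
    rw [inv_one] at h
    refine h.congr' ?_
    filter_upwards [eventually_gt_atTop 1] with N hN
    have h1 : (1 : ℝ) < N := Nat.one_lt_cast.2 hN
    have h2 : (N : ℝ) - 1 ≠ 0 := (sub_pos.2 h1).ne'
    have h3 : (N : ℝ) ≠ 0 := by positivity
    field_simp
  have hs : Tendsto (fun N : ℕ => -(((N : ℝ) / ((N : ℝ) - 1)) *
      ∑ i ∈ Finset.range n, ((N : ℝ) / ((N : ℝ) - 1)) ^ i)) atTop (𝓝 (-n)) := by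
    have h := (hr.mul (tendsto_finsetSum (Finset.range n) fun i _ => hr.pow i)).neg
    simpa using h
  refine hs.congr' ?_
  filter_upwards [eventually_gt_atTop 1] with N hN
  have h1 : (1 : ℝ) < N := Nat.one_lt_cast.2 hN
  have h2 : (N : ℝ) - 1 ≠ 0 := (sub_pos.2 h1).ne'
  have hg := geom_sum_mul ((N : ℝ) / ((N : ℝ) - 1)) n
  have h3 : (N : ℝ) / ((N : ℝ) - 1) - 1 = 1 / ((N : ℝ) - 1) := by
    field_simp
    ring
  rw [h3] at hg
  have h4 : 1 - ((N : ℝ) / ((N : ℝ) - 1)) ^ n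
      = -((∑ i ∈ Finset.range n, ((N : ℝ) / ((N : ℝ) - 1)) ^ i) * (1 / ((N : ℝ) - 1))) := by
    rw [hg]
    ring
  rw [h4]
  ring

namespace Model

variable {X : Type*} [MeasurableSpace X] {F : Model X} {G : ℝ} {M t : ℕ}

/-- Convergence in mean to a constant as the number of particles grows. -/
def MeanLim (F : Model X) (M t : ℕ) (f : ∀ N, Run X N M t → ℝ) (c : ℝ) : Prop :=
  Tendsto (fun N => ∫ z, |f N z - c| ∂F.runLaw N M t) atTop (𝓝 0)

namespace MeanLim

variable {f g : ∀ N, Run X N M t → ℝ} {c d : ℝ}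

theorem of_le {a : ℕ → ℝ} (ha : Tendsto a atTop (𝓝 0))
    (h : ∀ N : ℕ, NeZero N → ∫ z, |f N z - c| ∂F.runLaw N M t ≤ a N) : F.MeanLim M t f c := by
  refine squeeze_zero' (Eventually.of_forall fun N => integral_nonneg fun z => abs_nonneg _) ?_ ha
  filter_upwards [eventually_ge_atTop 1] with N hN
  exact h N ⟨by omega⟩

theorem congr' (h : F.MeanLim M t f c) (hfg : ∀ N, 1 < N → f N = g N) : F.MeanLim M t g c := by
  refine Tendsto.congr' ?_ h
  filter_upwards [eventually_gt_atTop 1] with N hN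
  rw [hfg N hN]

variable (hF : F.Regular G)
include hF

theorem add (hf : F.MeanLim M t f c) (hg : F.MeanLim M t g d)
    (hfb : ∀ N, NeZero N → BddMeas (f N)) (hgb : ∀ N, NeZero N → BddMeas (g N)) :
    F.MeanLim M t (fun N z => f N z + g N z) (c + d) := by
  have h := Tendsto.add hf hg
  rw [add_zero] at h
  refine of_le h fun N _ => ?_
  have := hF.isProbabilityMeasure_runLaw (N := N) M t
  have h1 := ((hfb N inferInstance).sub (BddMeas.const c)).abs
  have h2 := ((hgb N inferInstance).sub (BddMeas.const d)).abs
  rw [← integral_add (h1.integrable _) (h2.integrable _)]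
  refine integral_le_of_bddMeas (((hfb N inferInstance).add (hgb N inferInstance)).sub
    (BddMeas.const _)).abs (h1.add h2) _ fun z => ?_
  rw [show f N z + g N z - (c + d) = (f N z - c) + (g N z - d) by ring]
  exact abs_add_le _ _

theorem seq_mul {a : ℕ → ℝ} {a' : ℝ} (ha : Tendsto a atTop (𝓝 a')) (hf : F.MeanLim M t f c)
    (hfb : ∀ N, NeZero N → BddMeas (f N)) :
    F.MeanLim M t (fun N z => a N * f N z) (a' * c) := by
  have h := (ha.abs.mul hf).add (((ha.sub_const a').abs).mul_const |c|)
  rw [mul_zero, sub_self, abs_zero, zero_mul, add_zero] at h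
  refine of_le h fun N _ => ?_
  have := hF.isProbabilityMeasure_runLaw (N := N) M t
  have h1 := ((hfb N inferInstance).sub (BddMeas.const c)).abs
  have h2 : ∫ z, (|a N| * |f N z - c| + |a N - a'| * |c|) ∂F.runLaw N M t
      = |a N| * ∫ z, |f N z - c| ∂F.runLaw N M t + |a N - a'| * |c| := by
    rw [integral_add ((h1.const_mul _).integrable _) (integrable_const _), integral_const_mul]
    simp
  rw [← h2]
  refine integral_le_of_bddMeas (((hfb N inferInstance).const_mul _).sub
    (BddMeas.const _)).abs ((h1.const_mul _).add (BddMeas.const _)) _ fun z => ?_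
  rw [show a N * f N z - a' * c = a N * (f N z - c) + (a N - a') * c by ring, ← abs_mul,
    ← abs_mul]
  exact abs_add_le _ _

theorem sum {ι : Type*} (s : Finset ι) {f : ι → ∀ N, Run X N M t → ℝ} {c : ι → ℝ}
    (hf : ∀ i, F.MeanLim M t (f i) (c i)) (hfb : ∀ i N, NeZero N → BddMeas (f i N)) :
    F.MeanLim M t (fun N z => ∑ i ∈ s, f i N z) (∑ i ∈ s, c i) := by
  classical
  induction s using Finset.induction_on with
  | empty => simp [MeanLim]
  | insert i s hi ih =>
    simp only [Finset.sum_insert hi]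
    exact (hf i).add hF ih (hfb i) fun N hN => BddMeas.sum fun i => hfb i N hN

/-- Markov's inequality under `runLaw`. The probability spaces enter only through the law of `Z N`,
so no relation between different N is needed. -/
theorem measure_tendsto (hf : F.MeanLim M t f c) (hfb : ∀ N, NeZero N → BddMeas (f N))
    {Ω : ℕ → Type*} [∀ N, MeasurableSpace (Ω N)] {P : ∀ N, Measure (Ω N)}
    {Z : ∀ N, Ω N → Run X N M t} (hZ : ∀ N, 1 ≤ N → HasLaw (Z N) (F.runLaw N M t) (P N))
    {ε : ℝ} (hε : 0 < ε) :
    Tendsto (fun N => P N {ω | ε ≤ |f N (Z N ω) - c|}) atTop (𝓝 0) := by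
  have h : Tendsto (fun N => ENNReal.ofReal (ε⁻¹ * ∫ z, |f N z - c| ∂F.runLaw N M t)) atTop
      (𝓝 0) := by
    have := ENNReal.tendsto_ofReal (Tendsto.const_mul ε⁻¹ hf)
    simpa using this
  refine tendsto_of_tendsto_of_tendsto_of_le_of_le' tendsto_const_nhds h
    (Eventually.of_forall fun N => zero_le) ?_
  filter_upwards [eventually_ge_atTop 1] with N hN
  have : NeZero N := ⟨by omega⟩
  have := hF.isProbabilityMeasure_runLaw (N := N) M t
  have h1 := ((hfb N inferInstance).sub (BddMeas.const c)).abs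
  have hS : MeasurableSet {z : Run X N M t | ε ≤ |f N z - c|} :=
    measurableSet_le measurable_const h1.meas
  have h2 : P N {ω | ε ≤ |f N (Z N ω) - c|} = F.runLaw N M t {z | ε ≤ |f N z - c|} := by
    rw [← (hZ N hN).map_eq, Measure.map_apply_of_aemeasurable (hZ N hN).aemeasurable hS]
    rfl
  rw [h2, ← ofReal_measureReal]
  refine ENNReal.ofReal_le_ofReal ?_
  rw [le_inv_mul_iff₀ hε]
  exact mul_meas_ge_le_integral_of_nonneg (ae_of_all _ fun z => abs_nonneg _) (h1.integrable _) ε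

end MeanLim

/-! ### Limits in mean of the estimators -/

namespace Regular

variable (hF : F.Regular G)
include hF

theorem asymptVar_eq {h : X → ℝ} (hh : BddMeas h) :
    F.asymptVar t h = -((t + 1 : ℕ) : ℝ) * ((∫ x, h x ∂F.γ t) * ∫ x, h x ∂F.γ t)
      + ∑ b, F.pairLimit t b h h := by
  rw [hF.sum_pairLimit t hh hh, asymptVar, Finset.sum_sub_distrib, Finset.sum_const,
    Finset.card_range, nsmul_eq_mul]
  simp only [← pow_two]
  ring

variable [NeZero M]

theorem meanLim_gammaN {φ : X → ℝ} (hφ : BddMeas φ) :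
    F.MeanLim M t (fun _ z => F.gammaN z φ) (∫ x, φ x ∂F.γ t) := by
  obtain ⟨C, -, h⟩ := hF.exists_integral_sq_gammaN_sub_le M t hφ
  refine MeanLim.of_le (tendsto_sqrt_div_natCast C) fun N _ => ?_
  have := hF.isProbabilityMeasure_runLaw (N := N) M t
  exact (integral_abs_le_sqrt ((hF.bddMeas_gammaN hφ).sub (BddMeas.const _)) _).trans
    (Real.sqrt_le_sqrt (h N inferInstance))

/-- Convergence in mean passes to the product because γ_t^N(φ) is bounded uniformly in N. -/
theorem meanLim_gammaN_mul {φ ψ : X → ℝ} (hφ : BddMeas φ) (hψ : BddMeas ψ) :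
    F.MeanLim M t (fun _ z => F.gammaN z φ * F.gammaN z ψ)
      ((∫ x, φ x ∂F.γ t) * ∫ x, ψ x ∂F.γ t) := by
  obtain ⟨C, hC⟩ := hφ.bdd
  set a := ∫ x, φ x ∂F.γ t
  set c := ∫ x, ψ x ∂F.γ t
  set K : ℝ := G ^ t * |C| with hK
  have h := (Tendsto.const_mul K (hF.meanLim_gammaN (M := M) (t := t) hψ)).add
    (Tendsto.const_mul |c| (hF.meanLim_gammaN (M := M) (t := t) hφ))
  rw [mul_zero, mul_zero, add_zero] at h
  refine MeanLim.of_le h fun N _ => ?_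
  have := hF.isProbabilityMeasure_runLaw (N := N) M t
  have hN : (0 : ℝ) < N := Nat.cast_pos.2 (NeZero.pos N)
  have h1 := hF.bddMeas_gammaN (N := N) (M := M) (t := t) hφ
  have h2 := hF.bddMeas_gammaN (N := N) (M := M) (t := t) hψ
  have h1' := (h1.sub (BddMeas.const a)).abs.const_mul |c|
  have h2' := (h2.sub (BddMeas.const c)).abs.const_mul K
  have e : ∫ z, (K * |F.gammaN z ψ - c| + |c| * |F.gammaN z φ - a|) ∂F.runLaw N M t
      = K * ∫ z, |F.gammaN z ψ - c| ∂F.runLaw N M t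
        + |c| * ∫ z, |F.gammaN z φ - a| ∂F.runLaw N M t := by
    rw [integral_add (h2'.integrable _) (h1'.integrable _), integral_const_mul, integral_const_mul]
  refine (integral_le_of_bddMeas ((h1.mul h2).sub (BddMeas.const _)).abs (h2'.add h1') _
    fun z => ?_).trans e.le
  have hb : |F.gammaN z φ| ≤ K := by
    rw [gammaN, abs_mul, abs_of_nonneg (hF.weightProd_nonneg z)]
    refine mul_le_mul (hF.weightProd_le z) ?_ (abs_nonneg _)
      (pow_nonneg (zero_le_one.trans hF.one_le) t)
    rw [etaN, abs_mul, abs_of_nonneg (by positivity), inv_mul_le_iff₀ hN]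
    calc _ ≤ ∑ i, |φ (z.particles i)| := Finset.abs_sum_le_sum_abs _ _
      _ ≤ ∑ _i : Fin N, |C| := Finset.sum_le_sum fun i _ => (hC _).trans (le_abs_self C)
      _ = N * |C| := by simp
  rw [show F.gammaN z φ * F.gammaN z ψ - a * c
    = F.gammaN z φ * (F.gammaN z ψ - c) + c * (F.gammaN z φ - a) by ring]
  refine (abs_add_le _ _).trans (add_le_add ?_ (abs_mul _ _).le)
  rw [abs_mul]
  exact mul_le_mul_of_nonneg_right hb (abs_nonneg _)

theorem meanLim_pairEst_of_ne {b : Fin (t + 1) → Fin 2} (hb : b ≠ 0) {φ ψ : X → ℝ}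
    (hφ : BddMeas φ) (hψ : BddMeas ψ) : F.MeanLim M t (fun _ z => F.pairEst z b φ ψ) 0 := by
  obtain ⟨C, hC, h⟩ := hF.exists_integral_pairEst_le M t b hb
  obtain ⟨D, hD, hφψ⟩ := hφ.exists_abs_mul_le hψ
  refine MeanLim.of_le (tendsto_const_div_atTop_nhds_zero_nat (D * C)) fun N _ => ?_
  have := hF.isProbabilityMeasure_runLaw (N := N) M t
  refine (integral_le_of_bddMeas ((hF.bddMeas_pairEst b hφ hψ).sub (BddMeas.const _)).abs
    ((hF.bddMeas_pairEst b (BddMeas.const 1) (BddMeas.const 1)).const_mul D) _ fun z => ?_).trans ?_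
  · rw [sub_zero]
    exact abs_pairEst_le hF.pot_pos z b hφψ
  · rw [integral_const_mul, mul_div_assoc]
    exact mul_le_mul_of_nonneg_left (h N inferInstance) hD

/-- Subtract from γ_t^N(φ) γ_t^N(ψ) the estimators with b ≠ 0, all of which vanish in the limit. -/
theorem meanLim_pairEst_zero {φ ψ : X → ℝ} (hφ : BddMeas φ) (hψ : BddMeas ψ) :
    F.MeanLim M t (fun _ z => F.pairEst z 0 φ ψ) ((∫ x, φ x ∂F.γ t) * ∫ x, ψ x ∂F.γ t) := by
  have hneg : F.MeanLim M t (fun _ z => ∑ b : Fin (t + 1) → Fin 2,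
      if b = 0 then 0 else (-1) * F.pairEst z b φ ψ) (∑ _b : Fin (t + 1) → Fin 2, 0) := by
    refine MeanLim.sum hF _ (f := fun (b : Fin (t + 1) → Fin 2) _ z =>
      if b = 0 then 0 else (-1) * F.pairEst z b φ ψ) (c := fun _ => 0) (fun b => ?_) fun b N _ =>
      (BddMeas.const 0).ite_const _ ((hF.bddMeas_pairEst b hφ hψ).const_mul _)
    by_cases hb : b = 0
    · simp [hb, MeanLim]
    · have h := MeanLim.seq_mul hF (tendsto_const_nhds (x := (-1 : ℝ)))
        (hF.meanLim_pairEst_of_ne (M := M) hb hφ hψ) fun N _ => hF.bddMeas_pairEst b hφ hψ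
      simpa [hb] using h
  have h := (hF.meanLim_gammaN_mul (M := M) (t := t) hφ hψ).add hF hneg
    (fun N _ => (hF.bddMeas_gammaN hφ).mul (hF.bddMeas_gammaN hψ))
    fun N _ => BddMeas.sum fun b =>
      (BddMeas.const 0).ite_const _ ((hF.bddMeas_pairEst b hφ hψ).const_mul _)
  rw [Finset.sum_const_zero, add_zero] at h
  refine h.congr' fun N _ => ?_
  funext z
  rw [← sum_pairEst hF.pot_pos (NeZero.ne M), ← Finset.sum_add_distrib,
    Finset.sum_eq_single (0 : Fin (t + 1) → Fin 2)]
  · simp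
  · intro b _ hb
    simp [hb]
  · simp

theorem meanLim_mul_pairEst {b : Fin (t + 1) → Fin 2} (hb : b ≠ 0) {φ ψ : X → ℝ}
    (hφ : BddMeas φ) (hψ : BddMeas ψ) :
    F.MeanLim M t (fun N z => N * F.pairEst z b φ ψ) (F.pairLimit t b φ ψ) := by
  induction t generalizing φ ψ with
  | zero =>
    have hb0 := fin_one_ne_zero hb
    have h := hF.meanLim_gammaN (M := M) (t := 0) (hφ.mul hψ)
    rw [pairLimit, if_neg hb0]
    refine h.congr' fun N hN => ?_
    funext z
    have hN' : (N : ℝ) ≠ 0 := Nat.cast_ne_zero.2 (by omega)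
    rw [pairEst_time_zero z hb0, mul_inv_cancel_left₀ hN']
  | succ t ih =>
    set E : ∀ N, Run X N M t → ℝ := fun N z =>
      ∫ m, F.pairEst (z.extend m) b φ ψ ∂F.stepKernel N M t z.particles with hE
    have hq : ∀ N, NeZero N → BddMeas fun z : Run X N M (t + 1) => F.pairEst z b φ ψ :=
      fun N _ => hF.bddMeas_pairEst b hφ hψ
    have hEb : ∀ N, NeZero N → BddMeas (E N) := fun N _ =>
      hF.bddMeas_integral_stepKernel (hq N inferInstance)
    -- The conditional mean. With last bit 0 it is covered by the induction hypothesis. With last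
    -- bit 1 the factor N is spent on 1/N, and the unscaled estimator at the shorter word has a
    -- nonzero limit only if that word is 0.
    have hElim : F.MeanLim M t (fun N z => N * E N z) (F.pairLimit (t + 1) b φ ψ) := by
      rw [pairLimit]
      by_cases hl : b (Fin.last (t + 1)) = 0
      · rw [if_pos hl]
        have hQφ := hF.bddMeas_QInt (t := t) hφ
        have hQψ := hF.bddMeas_QInt (t := t) hψ
        have h := MeanLim.seq_mul hF tendsto_one_sub_inv_natCast
          (ih (castSucc_ne_zero hb hl) hQφ hQψ)
          fun N _ => (hF.bddMeas_pairEst _ hQφ hQψ).const_mul _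
        rw [one_mul] at h
        refine h.congr' fun N hN => ?_
        have : NeZero N := ⟨by omega⟩
        funext z
        rw [hE]
        simp only [hF.integral_pairEst_extend_zero z hl hφ hψ]
        ring
      · rw [if_neg hl]
        have hQφ := hF.bddMeas_QInt (t := t) (hφ.mul hψ)
        have hQ1 := hF.bddMeas_QInt (t := t) (BddMeas.const 1)
        have h : F.MeanLim M t (fun _ z => F.pairEst z (fun s => b s.castSucc)
            (F.QInt t fun x => φ x * ψ x) (F.QInt t fun _ => 1))
            (if (fun s => b s.castSucc) = (0 : Fin (t + 1) → Fin 2) then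
              (∫ x, φ x * ψ x ∂F.γ (t + 1)) * ∫ _, 1 ∂F.γ (t + 1) else 0) := by
          split_ifs with h0
          · rw [h0, hF.integral_γ_succ t (hφ.mul hψ), hF.integral_γ_succ t (BddMeas.const 1)]
            exact hF.meanLim_pairEst_zero hQφ hQ1
          · exact hF.meanLim_pairEst_of_ne h0 hQφ hQ1
        refine h.congr' fun N hN => ?_
        have : NeZero N := ⟨by omega⟩
        funext z
        have hN' : (N : ℝ) ≠ 0 := Nat.cast_ne_zero.2 (by omega)
        rw [hE]
        simp only [hF.integral_pairEst_extend_one z hl hφ hψ]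
        rw [mul_inv_cancel_left₀ hN']
    obtain ⟨D, hD, hφψ⟩ := hφ.exists_abs_mul_le hψ
    obtain ⟨C, hC, h⟩ := hF.exists_integral_rowMomentBound_le b hb
      (hF.exists_integral_rowMoment_le M t)
    set K : ℝ := 8 * D ^ 2 * G ^ (t + 1) * C with hK
    have hlim := (tendsto_sqrt_div_natCast K).add hElim
    rw [add_zero] at hlim
    refine MeanLim.of_le hlim fun N _ => ?_
    have hN : (0 : ℝ) < N := Nat.cast_pos.2 (NeZero.pos N)
    have := hF.isProbabilityMeasure_runLaw (N := N) M t
    have := hF.isProbabilityMeasure_runLaw (N := N) M (t + 1)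
    have hG0 : 0 ≤ G := zero_le_one.trans hF.one_le
    have hd : BddMeas fun z : Run X N M (t + 1) => F.pairEst z b φ ψ - E N z.prev :=
      (hq N inferInstance).sub ((hEb N inferInstance).comp measurable_prev)
    have hE' : BddMeas fun z : Run X N M t => |N * E N z - F.pairLimit (t + 1) b φ ψ| :=
      (((hEb N inferInstance).const_mul _).sub (BddMeas.const _)).abs
    -- The row moment is O(N), so this variance is O(N⁻³); after multiplication by N² it is the K/N
    -- below.
    have hvar : ∫ z, (F.pairEst z b φ ψ - E N z.prev) ^ 2 ∂F.runLaw N M (t + 1)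
        ≤ 8 * D ^ 2 * G ^ (t + 1) / (N : ℝ) ^ 4 * (C * N) := by
      rw [hF.integral_runLaw_succ (hd.pow 2)]
      refine (integral_le_of_bddMeas (hF.bddMeas_integral_stepKernel (hd.pow 2))
        ((hF.bddMeas_rowMomentBound b).const_mul (8 * D ^ 2 * G ^ (t + 1) / (N : ℝ) ^ 4)) _
        fun z => hF.integral_sq_pairEst_extend_sub_le z b hφ hψ hD hφψ).trans ?_
      rw [integral_const_mul]
      exact mul_le_mul_of_nonneg_left (h N inferInstance) (by positivity)
    have hdev : ∫ z, |(N : ℝ) * (F.pairEst z b φ ψ - E N z.prev)| ∂F.runLaw N M (t + 1)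
        ≤ √(K / N) := by
      refine (integral_abs_le_sqrt (hd.const_mul _) _).trans (Real.sqrt_le_sqrt ?_)
      simp_rw [mul_pow]
      rw [integral_const_mul]
      calc _ ≤ (N : ℝ) ^ 2 * (8 * D ^ 2 * G ^ (t + 1) / (N : ℝ) ^ 4 * (C * N)) :=
            mul_le_mul_of_nonneg_left hvar (by positivity)
        _ = K / N := by
            rw [hK]
            field_simp
    have hdb := (hd.const_mul (N : ℝ)).abs
    have hEp := hE'.comp (measurable_prev (X := X) (N := N) (M := M) (t := t))
    calc _ ≤ ∫ z, (|(N : ℝ) * (F.pairEst z b φ ψ - E N z.prev)|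
          + |N * E N z.prev - F.pairLimit (t + 1) b φ ψ|) ∂F.runLaw N M (t + 1) := by
          refine integral_le_of_bddMeas (((hq N inferInstance).const_mul _).sub
            (BddMeas.const _)).abs (hdb.add hEp) _ fun z => ?_
          rw [show (N : ℝ) * F.pairEst z b φ ψ - F.pairLimit (t + 1) b φ ψ
            = N * (F.pairEst z b φ ψ - E N z.prev)
              + (N * E N z.prev - F.pairLimit (t + 1) b φ ψ) by ring]
          exact abs_add_le _ _
      _ ≤ _ := by
          rw [integral_add (hdb.integrable _) (hEp.integrable _), hF.integral_prev hE']
          exact add_le_add hdev le_rfl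

/-- Replace γ_t^N(h)² by the sum of all `pairEst` and collect the terms at b = 0. The identity
persists at N = 1, where N/(N-1) is 0 on both sides. -/
theorem varEst_eq {N : ℕ} [NeZero N] (z : Run X N M t) (h : X → ℝ) :
    F.varEst z h = N * (1 - ((N : ℝ) / ((N : ℝ) - 1)) ^ (t + 1)) * F.pairEst z 0 h h
      + ∑ b, if b = 0 then 0 else N * F.pairEst z b h h := by
  have hN : (N : ℝ) ≠ 0 := Nat.cast_ne_zero.2 (NeZero.ne N)
  have h1 : F.muEst z 0 (fun x y => h x * h y)
      = ((N : ℝ) / ((N : ℝ) - 1)) ^ (t + 1) * F.pairEst z 0 h h := by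
    simp [muEst, pairEst, gammaN, etaN, hN, mul_assoc, div_pow]
  have h2 : ∑ b, F.pairEst z b h h
      = F.pairEst z 0 h h + ∑ b, if b = 0 then 0 else F.pairEst z b h h := by
    rw [← Finset.add_sum_erase _ _ (Finset.mem_univ (0 : Fin (t + 1) → Fin 2))]
    congr 1
    rw [← Finset.add_sum_erase _ (fun b => if b = 0 then 0 else F.pairEst z b h h)
      (Finset.mem_univ (0 : Fin (t + 1) → Fin 2)), if_pos rfl, zero_add]
    exact Finset.sum_congr rfl fun b hb => (if_neg (Finset.ne_of_mem_erase hb)).symm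
  have h3 : ∑ b : Fin (t + 1) → Fin 2, (if b = 0 then 0 else N * F.pairEst z b h h)
      = N * ∑ b, if b = 0 then 0 else F.pairEst z b h h := by
    rw [Finset.mul_sum]
    exact Finset.sum_congr rfl fun b _ => by split_ifs <;> simp
  rw [varEst, h1, h3, pow_two, ← sum_pairEst hF.pot_pos (NeZero.ne M), h2]
  ring

theorem meanLim_varEst {h : X → ℝ} (hh : BddMeas h) :
    F.MeanLim M t (fun _ z => F.varEst z h) (F.asymptVar t h) := by
  rw [hF.asymptVar_eq hh]
  have hb : ∀ (b : Fin (t + 1) → Fin 2) (N : ℕ), NeZero N →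
      BddMeas fun z : Run X N M t => if b = 0 then 0 else (N : ℝ) * F.pairEst z b h h :=
    fun b N _ => (BddMeas.const 0).ite_const _ ((hF.bddMeas_pairEst b hh hh).const_mul _)
  have h1 := MeanLim.seq_mul hF (tendsto_mul_one_sub_pow (t + 1))
    (hF.meanLim_pairEst_zero (M := M) (t := t) hh hh) fun N _ => hF.bddMeas_pairEst 0 hh hh
  have h2 := MeanLim.sum hF Finset.univ (f := fun (b : Fin (t + 1) → Fin 2) N
    (z : Run X N M t) => if b = 0 then 0 else (N : ℝ) * F.pairEst z b h h)
    (c := fun b => F.pairLimit t b h h) (fun b => by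
      by_cases h0 : b = 0
      · simp [h0, MeanLim, pairLimit_zero]
      · simpa [h0] using hF.meanLim_mul_pairEst (M := M) h0 hh hh) hb
  refine (h1.add hF h2 (fun N _ => (hF.bddMeas_pairEst 0 hh hh).const_mul _)
    fun N hN => BddMeas.sum fun b => hb b N hN).congr' fun N hN => ?_
  have : NeZero N := ⟨by omega⟩
  funext z
  exact (hF.varEst_eq z h).symm

theorem bddMeas_varEst {N : ℕ} [NeZero N] {h : X → ℝ} (hh : BddMeas h) :
    BddMeas fun z : Run X N M t => F.varEst z h := by
  simp only [hF.varEst_eq]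
  exact ((hF.bddMeas_pairEst 0 hh hh).const_mul _).add (BddMeas.sum fun b =>
    (BddMeas.const 0).ite_const _ ((hF.bddMeas_pairEst b hh hh).const_mul _))

end Regular

end Model

end Paris

end

/-! ### From convergence in mean to the theorem -/

theorem mainTheorem5 {X : Type*} [MeasurableSpace X] (F : Paris.Model X)
    (hA1 : F.HasDensities) (hA2 : F.PotentialsPosBounded)
    (hA3 : F.DensitiesPos) (hA4 : F.DensitiesBounded)
    (t M : ℕ) (hM : 1 < M) (h : X → ℝ) (hmeas : Measurable h) (hbdd : ∃ C : ℝ, ∀ x, |h x| ≤ C)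
    (Ω : ℕ → Type*) [∀ N, MeasurableSpace (Ω N)] (P : ∀ N, Measure (Ω N))
    (Z : ∀ N, Ω N → Paris.Run X N M t)
    (hZ : ∀ N, 1 ≤ N → HasLaw (Z N) (F.runLaw N M t) (P N)) :
    (∀ ε : ℝ, 0 < ε →
        Tendsto (fun N => P N {ω | ε ≤ |F.varEst (Z N ω) h - F.asymptVar t h|}) atTop (𝓝 0)) ∧
      ∀ (N : ℕ) (z : Paris.Run X N M t) (k l : Fin N), ∑ b, F.coalStat z b k l = 1 := by
  obtain ⟨G, -, hG⟩ := hA2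
  have hF : F.Regular (max G 1) :=
    { hasDensities := hA1
      dens_pos := hA3
      pot_pos := fun t x => (hG t x).1
      pot_le := fun t x => (hG t x).2.trans (le_max_left _ _)
      one_le := le_max_right _ _ }
  have : NeZero M := ⟨by omega⟩
  have hh : Paris.BddMeas h := ⟨hmeas, hbdd⟩
  exact ⟨fun ε hε => (hF.meanLim_varEst hh).measure_tendsto hF
      (fun N _ => hF.bddMeas_varEst hh) hZ hε,
    fun N z k l => Paris.Model.sum_coalStat hF.pot_pos (NeZero.ne M) z k l⟩
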